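/- **Conventions.** $\mathcal{A}ss$ is the associative operad: the single-coloured symmetric operad in sets with $\mathcal{A}ss(n)=\Sigma_n$ ($n\ge 0$), on which $\Sigma_n$ acts from the right by multiplication, and with composition given by concatenating linear orders. Here $\sigma=[\sigma(1),\dots,\sigma(n)]\in\Sigma_n$ is the order on the inputs $1,\dots,n$ in which the $k$-th input has position $\sigma(k)$. Let $\langle n\rangle=\{0,1,\dots,n\}$ be pointed at $0$, and let $\mathrm{Fin}_*$ be the category of the $\langle n\rangle$ and the pointed maps. For a symmetric operad $\mathcal{P}$ in sets with one colour, $\mathbf{Ib}^{\mathcal{P}}$ is the category with objects $m\in\mathbb{N}$ in which a morphism $m\to n$ is a pointed map $f:\langle n\rangle\to\langle m\rangle$ together with operations $\alpha_0$, with inputs labelled by $f^{-1}(0)$ (the basepoint being the first, distinguished input), and $\alpha_i$, with inputs labelled by $f^{-1}(i)$, for $i=1,\dots,m$; identities are given by unit operations. The composite of $(f,\alpha):l\to m$ and $(g,\beta):m\to n$ lies over $f\circ g$, with operations $\alpha_i\circ(\beta_j)_{j\in f^{-1}(i)}$ for $i\ge1$ and $\beta_0\circ_1\bigl(\alpha_0\circ(\beta_j)_{0\ne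 j\in f^{-1}(0)}\bigr)$ over $0$. The twisted arrow category $\mathrm{Tw}(\mathcal{P})$ is the category of elements of the functor $\mathcal{P}:\mathbf{Ib}^{\mathcal{P}}\to\mathrm{Set}$, $m\mapsto\mathcal{P}(m)$, which takes $(f,\alpha):m\to n$ to the map $\alpha^*:\mathcal P(m)\to\mathcal P(n)$, where $\alpha^*(\theta)$ is $\alpha_0\circ_1\theta\circ(\alpha_1,\dots,\alpha_m)$ with its inputs relabelled by $1,\dots,n$. So its objects are the operations of $\mathcal{P}$, and a morphism $\mu\to\nu$ from $\mu\in\mathcal P(m)$ to $\nu\in\mathcal P(n)$ is a morphism $(f,\alpha):m\to n$ of $\mathbf{Ib}^{\mathcal{P}}$ with $\alpha^*(\mu)=\nu$. Let $\iota:\Delta\to\mathrm{Fin}_*^{\mathrm{op}}$ be the functor with $\iota([n])=\langle n\rangle$ that takes a monotone map $f:[m]\to[n]$ to the map $\iota_{m,n}(f):\langle n\rangle\to\langle m\rangle$ which sends $j\in\{1,\dots,n\}$ to the unique $i\in\{1,\dots,m\}$ with $f(i-1)<j\le f(i)$ if there is one, and to $0$ otherwise. Let $\mathrm{const}_0:\langle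 n\rangle\to\langle m\rangle$ be the constant map with value $0$, and put $\mathrm{im}^\circ(\iota_{m,n})=\mathrm{im}(\iota_{m,n})\setminus\{\mathrm{const}_0\}$. Let $\mu_n\in\Sigma_n$ be the identity permutation. **Proposition.** There is an equivalence of categories $\varphi:\Delta\to\mathrm{Tw}(\mathcal{A}ss)$ with $\varphi([n])=\mu_n$ for all $n\ge0$ that has the following properties for all $m,n\ge 0$. The map $\varphi_{m,n}:\mathrm{Hom}_\Delta([m],[n])\to\mathrm{Hom}_{\mathrm{Tw}(\mathcal{A}ss)}(\mu_m,\mu_n)$ is a bijection, and splits into two bijections as follows. 1. The constant maps $[m]\to[n]$ correspond to the morphisms $\mu_m\to\mu_n$ over $\mathrm{const}_0$. There are exactly $n+1$ such morphisms, namely those with $\alpha_0=\alpha_0^{i}:=[i,1,\dots,i-1,i+1,\dots,n+1]\in\Sigma_{n+1}$ for $i=1,\dots,n+1$ (the operations $\alpha_1,\dots,\alpha_m$ have no inputs), and $\varphi_{m,n}$ takes the constant map with value $i\in\{0,\dots,n\}$ to the one with $\alpha_0=\alpha_0^{i+1}$. 2. For every $f:[m]\to[n]$ the morphism $\varphi_{m,n}(f)$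 lies over $\iota_{m,n}(f)$. The non-constant maps $[m]\to[n]$ correspond to the morphisms $\mu_m\to\mu_n$ that do not lie over $\mathrm{const}_0$. Taking underlying maps of pointed sets is a bijection from these morphisms to $\mathrm{im}^\circ(\iota_{m,n})$, and $\iota_{m,n}$ restricts to a bijection from the non-constant maps $[m]\to[n]$ to $\mathrm{im}^\circ(\iota_{m,n})$. -/

import Mathlib

open CategoryTheory

/-! ## Symmetric operads in sets -/

/-- A (single-coloured) symmetric operad in sets, in coordinate-free form: operations have their
inputs labelled by an arbitrary finite type `S`, bijections relabel the inputs, and an operation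
with inputs `J` is composed with a family of operations with inputs `I j`, `j : J`.
The set of `n`-ary operations is `Op (Fin n)`, on which a permutation `σ` acts from the right by
`μ ^ σ = map σ⁻¹ μ` (the `k`-th input of `μ ^ σ` is the `σ k`-th input of `μ`). -/
structure SymmOperad where
  /-- Operations with inputs labelled by `S`. -/
  Op : (S : Type) → [Finite S] → Type
  /-- Relabelling of the inputs. -/
  map : {S T : Type} → [Finite S] → [Finite T] → (S ≃ T) → Op S → Op T
  /-- The unit operation. -/
  one : Op Unit
  /-- Total composition. -/
  comp : {J : Type} → {I : J → Type} → [Finite J] → [∀ j, Finite (I j)] →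
    Op J → (∀ j, Op (I j)) → Op (Σ j, I j)
  map_refl : ∀ {S : Type} [Finite S] (μ : Op S), map (Equiv.refl S) μ = μ
  map_map : ∀ {S T U : Type} [Finite S] [Finite T] [Finite U] (e : S ≃ T) (e' : T ≃ U)
    (μ : Op S), map e' (map e μ) = map (e.trans e') μ
  /-- Equivariance in the outer operation. -/
  comp_map_left : ∀ {J J' : Type} {I : J' → Type} [Finite J] [Finite J'] [∀ j, Finite (I j)]
    (e : J ≃ J') (μ : Op J) (ν : ∀ j, Op (I j)),
    comp (map e μ) ν = map (Equiv.sigmaCongrLeft e) (comp μ (fun j => ν (e j)))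
  /-- Equivariance in the inner operations. -/
  comp_map_right : ∀ {J : Type} {I I' : J → Type} [Finite J] [∀ j, Finite (I j)]
    [∀ j, Finite (I' j)] (e : ∀ j, I j ≃ I' j) (μ : Op J) (ν : ∀ j, Op (I j)),
    comp μ (fun j => map (e j) (ν j)) = map (Equiv.sigmaCongrRight e) (comp μ ν)
  /-- Associativity. -/
  comp_assoc : ∀ {J : Type} {I : J → Type} {K : ∀ j, I j → Type} [Finite J] [∀ j, Finite (I j)]
    [∀ j i, Finite (K j i)] (μ : Op J) (ν : ∀ j, Op (I j)) (ξ : ∀ j i, Op (K j i)),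
    map (Equiv.sigmaAssoc K) (comp (comp μ ν) (fun x => ξ x.1 x.2)) =
      comp μ (fun j => comp (ν j) (ξ j))
  /-- Left unit law. -/
  one_comp : ∀ {S : Type} [Finite S] (μ : Op S),
    map (Equiv.uniqueSigma fun _ : Unit => S) (comp one (fun _ => μ)) = μ
  /-- Right unit law. -/
  comp_one : ∀ {S : Type} [Finite S] (μ : Op S),
    map (Equiv.sigmaUnique S fun _ => Unit) (comp μ (fun _ => one)) = μ

namespace SymmOperad

variable (P : SymmOperad)

/-- Total composition, with the inputs of the result relabelled along `e`. -/
def gcomp {J S : Type} {I : J → Type} [Finite J] [∀ j, Finite (I j)] [Finite S]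
    (e : (Σ j, I j) ≃ S) (μ : P.Op J) (ν : ∀ j, P.Op (I j)) : P.Op S :=
  P.map e (P.comp μ ν)

instance {A : Type} {C : Type} {I : A → Type} [Finite C] [∀ a, Finite (I a)] (o : Option A) :
    Finite (o.elim C I) := by
  cases o <;> simp only [Option.elim] <;> infer_instance

/-- A sum over `Option A` is the sum of the term `C` of `none` and of the terms `I a` of `some a`. -/
def optSigma {A C : Type} {I : A → Type} : (Σ o : Option A, o.elim C I) ≃ C ⊕ (Σ a, I a) where
  toFun
    | ⟨none, c⟩ => Sum.inl c
    | ⟨some a, x⟩ => Sum.inr ⟨a, x⟩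
  invFun
    | Sum.inl c => ⟨none, c⟩
    | Sum.inr ⟨a, x⟩ => ⟨some a, x⟩
  left_inv := by rintro ⟨_ | a, x⟩ <;> rfl
  right_inv := by rintro (c | ⟨a, x⟩) <;> rfl

/-- The equivalence `Option C ⊕ B ≃ Option (C ⊕ B)`. -/
def optSum {B C : Type} : Option C ⊕ B ≃ Option (C ⊕ B) where
  toFun
    | Sum.inl none => none
    | Sum.inl (some c) => some (Sum.inl c)
    | Sum.inr b => some (Sum.inr b)
  invFun
    | none => Sum.inl none
    | some (Sum.inl c) => Sum.inl (some c)
    | some (Sum.inr b) => Sum.inr b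
  left_inv := by rintro ((_ | c) | b) <;> rfl
  right_inv := by rintro (_ | (c | b)) <;> rfl

/-- An operation `θ` for the input `none` and operations `ν a` for the inputs `some a`. -/
def optFam {A C : Type} {I : A → Type} [Finite C] [∀ a, Finite (I a)]
    (θ : P.Op C) (ν : ∀ a, P.Op (I a)) : ∀ o : Option A, P.Op (o.elim C I)
  | none => θ
  | some a => ν a

/-- Partial composition: `θ` is plugged into the input `none` of `β`. The remaining inputs
`some b` of `β` are kept. -/
def ins {B C S : Type} [Finite B] [Finite C] [Finite S] (e : C ⊕ B ≃ S)
    (β : P.Op (Option B)) (θ : P.Op C) : P.Op S :=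
  P.gcomp (optSigma.trans ((Equiv.sumCongr (Equiv.refl C) (Equiv.sigmaUnique B _)).trans e)) β
    (P.optFam (I := fun _ => Unit) θ (fun _ => P.one))

/-- Composition at all inputs but `none`: `ν a` is plugged into the input `some a` of `μ`, and the
input `none` of `μ` is kept. -/
def ptc {A S : Type} {I : A → Type} [Finite A] [∀ a, Finite (I a)] [Finite S]
    (e : (Σ a, I a) ≃ S) (μ : P.Op (Option A)) (ν : ∀ a, P.Op (I a)) : P.Op (Option S) :=
  P.gcomp (optSigma.trans ((Equiv.sumComm Unit _).trans
    ((Equiv.optionEquivSumPUnit _).symm.trans (Equiv.optionCongr e)))) μ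
    (P.optFam (C := Unit) P.one ν)

/-- The partial composition `ins` of operations which both have a distinguished input `none`:
the distinguished input of the result is that of `θ`. -/
def insP {B C W : Type} [Finite B] [Finite C] [Finite W] (e : C ⊕ B ≃ W)
    (β : P.Op (Option B)) (θ : P.Op (Option C)) : P.Op (Option W) :=
  P.ins (optSum.trans (Equiv.optionCongr e)) β θ

section lemmas

variable {P}

theorem map_eq_self {S : Type} [Finite S] (e : S ≃ S) (h : ∀ x, e x = x) (μ : P.Op S) :
    P.map e μ = μ := by
  have : e = Equiv.refl S := Equiv.ext h
  rw [this, P.map_refl]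

theorem map_gcomp {J S T : Type} {I : J → Type} [Finite J] [∀ j, Finite (I j)] [Finite S]
    [Finite T] (e : (Σ j, I j) ≃ S) (e' : S ≃ T) (μ : P.Op J) (ν : ∀ j, P.Op (I j)) :
    P.map e' (P.gcomp e μ ν) = P.gcomp (e.trans e') μ ν := by
  simp only [gcomp, P.map_map]

theorem gcomp_congr {J S : Type} {I I' : J → Type} [Finite J] [∀ j, Finite (I j)]
    [∀ j, Finite (I' j)] [Finite S] (e : (Σ j, I j) ≃ S) (e' : (Σ j, I' j) ≃ S)
    (μ : P.Op J) (ν : ∀ j, P.Op (I j)) (ν' : ∀ j, P.Op (I' j))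
    (ε : ∀ j, I j ≃ I' j) (hν : ∀ j, P.map (ε j) (ν j) = ν' j)
    (he : ∀ j x, e' ⟨j, ε j x⟩ = e ⟨j, x⟩) :
    P.gcomp e μ ν = P.gcomp e' μ ν' := by
  obtain rfl : (fun j => P.map (ε j) (ν j)) = ν' := funext hν
  simp only [gcomp, P.comp_map_right, P.map_map]
  congr 1
  ext ⟨j, x⟩
  exact (he j x).symm

theorem gcomp_assoc {J T S : Type} {I : J → Type} {K : T → Type} {M : J → Type} [Finite J]
    [∀ j, Finite (I j)] [Finite T] [∀ t, Finite (K t)] [Finite S] [∀ j, Finite (M j)]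
    (e₁ : (Σ j, I j) ≃ T) (e : (Σ t, K t) ≃ S)
    (μ : P.Op J) (ν : ∀ j, P.Op (I j)) (ξ : ∀ t, P.Op (K t))
    (e₃ : ∀ j, (Σ i, K (e₁ ⟨j, i⟩)) ≃ M j) (e₂ : (Σ j, M j) ≃ S)
    (he : ∀ j i x, e₂ ⟨j, e₃ j ⟨i, x⟩⟩ = e ⟨e₁ ⟨j, i⟩, x⟩) :
    P.gcomp e (P.gcomp e₁ μ ν) ξ =
      P.gcomp e₂ μ (fun j => P.gcomp (e₃ j) (ν j) (fun i => ξ (e₁ ⟨j, i⟩))) := by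
  have h := P.comp_assoc μ ν (fun j i => ξ (e₁ ⟨j, i⟩))
  simp only [gcomp, P.comp_map_left, P.comp_map_right, P.map_map, ← h]
  congr 1
  ext ⟨⟨j, i⟩, x⟩
  exact (he j i x).symm

theorem gcomp_one {J S : Type} [Finite J] [Finite S] (e : (Σ _ : J, Unit) ≃ S) (e' : J ≃ S)
    (h : ∀ j, e ⟨j, ()⟩ = e' j) (μ : P.Op J) :
    P.gcomp e μ (fun _ => P.one) = P.map e' μ := by
  conv_rhs => rw [← P.comp_one μ, P.map_map]
  rw [gcomp]
  congr 1
  ext ⟨j, _⟩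
  exact h j

theorem one_gcomp {S S' : Type} [Finite S] [Finite S'] (e : (Σ _ : Unit, S) ≃ S') (e' : S ≃ S')
    (h : ∀ x, e ⟨(), x⟩ = e' x) (μ : P.Op S) :
    P.gcomp e P.one (fun _ => μ) = P.map e' μ := by
  conv_rhs => rw [← P.one_comp μ, P.map_map]
  rw [gcomp]
  congr 1
  ext ⟨j, x⟩
  exact h x

theorem ins_ins {B C D S T W : Type} [Finite B] [Finite C] [Finite D] [Finite S] [Finite T]
    [Finite W] (e : T ⊕ D ≃ S) (e₁ : C ⊕ B ≃ T) (e₂ : C ⊕ W ≃ S) (e₃ : B ⊕ D ≃ W)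
    (γ : P.Op (Option D)) (β : P.Op (Option B)) (θ : P.Op C)
    (h₁ : ∀ c, e₂ (.inl c) = e (.inl (e₁ (.inl c))))
    (h₂ : ∀ b, e₂ (.inr (e₃ (.inl b))) = e (.inl (e₁ (.inr b))))
    (h₃ : ∀ d, e₂ (.inr (e₃ (.inr d))) = e (.inr d)) :
    P.ins e γ (P.ins e₁ β θ) = P.ins e₂ (P.insP e₃ γ β) θ := by
  symm
  unfold insP ins
  refine (gcomp_assoc _ _ _ _ _
    (M := fun o : Option D => o.elim T fun _ => Unit)
    (fun o => match o with
      | none => (Equiv.sigmaCongrRight (fun i : Option B => match i with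
          | none => Equiv.refl C
          | some _ => Equiv.refl Unit)).trans (optSigma.trans
            ((Equiv.sumCongr (Equiv.refl C) (Equiv.sigmaUnique B _)).trans e₁))
      | some _ => Equiv.uniqueSigma (fun _ : Unit => Unit))
    (optSigma.trans ((Equiv.sumCongr (Equiv.refl T) (Equiv.sigmaUnique D _)).trans e)) ?_).trans ?_
  · rintro (_ | d) i x
    · cases i with
      | none => exact (h₁ x).symm
      | some b => exact (h₂ b).symm
    · exact (h₃ d).symm
  · congr 1
    funext o
    cases o with
    | none =>
      refine gcomp_congr (J := Option B) (I' := fun i : Option B => i.elim C fun _ => Unit)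
        _ _ _ _ _ (fun i => match i with
          | none => Equiv.refl C
          | some _ => Equiv.refl Unit) ?_ ?_
      · rintro (_ | b)
        · exact P.map_refl _
        · exact P.map_refl _
      · rintro (_ | b) x <;> rfl
    | some d =>
      exact (one_gcomp _ (Equiv.refl Unit) (fun _ => rfl) _).trans (P.map_refl _)

theorem gcomp_ins {B C T S W V : Type} {K : T → Type} [Finite B] [Finite C] [Finite T] [Finite S]
    [Finite W] [Finite V] [∀ t, Finite (K t)] (e₁ : C ⊕ B ≃ T) (e : (Σ t, K t) ≃ S)
    (e₃ : (Σ b, K (e₁ (.inr b))) ≃ W) (e₄ : (Σ c, K (e₁ (.inl c))) ≃ V) (e₂ : V ⊕ W ≃ S)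
    (β : P.Op (Option B)) (θ : P.Op C) (ξ : ∀ t, P.Op (K t))
    (h₁ : ∀ c x, e₂ (.inl (e₄ ⟨c, x⟩)) = e ⟨e₁ (.inl c), x⟩)
    (h₂ : ∀ b x, e₂ (.inr (e₃ ⟨b, x⟩)) = e ⟨e₁ (.inr b), x⟩) :
    P.gcomp e (P.ins e₁ β θ) ξ =
      P.ins e₂ (P.ptc e₃ β (fun b => ξ (e₁ (.inr b))))
        (P.gcomp e₄ θ (fun c => ξ (e₁ (.inl c)))) := by
  have E : P.gcomp e (P.ins e₁ β θ) ξ =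
      P.gcomp (I := fun o : Option B => o.elim V fun b => K (e₁ (.inr b)))
        (optSigma.trans ((Equiv.sumCongr (Equiv.refl V) e₃).trans e₂)) β
        (P.optFam (P.gcomp e₄ θ (fun c => ξ (e₁ (.inl c)))) (fun b => ξ (e₁ (.inr b)))) := by
    unfold ins
    refine (gcomp_assoc _ _ _ _ _
      (M := fun o : Option B => o.elim V fun b => K (e₁ (.inr b)))
      (fun o => match o with
        | none => e₄
        | some b => Equiv.uniqueSigma (fun _ : Unit => K (e₁ (.inr b))))
      (optSigma.trans ((Equiv.sumCongr (Equiv.refl V) e₃).trans e₂)) ?_).trans ?_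
    · rintro (_ | b) i x
      · exact h₁ i x
      · exact h₂ b x
    · congr 1
      funext o
      cases o with
      | none => rfl
      | some b =>
        exact (one_gcomp (Equiv.uniqueSigma (fun _ : Unit => K (e₁ (.inr b)))) (Equiv.refl _)
          (fun _ => rfl) (ξ (e₁ (.inr b)))).trans (P.map_refl _)
  rw [E]
  symm
  unfold ins ptc
  refine (gcomp_assoc _ _ _ _ _
    (M := fun o : Option B => o.elim V fun b => K (e₁ (.inr b)))
    (fun o => match o with
      | none => Equiv.uniqueSigma (fun _ : Unit => V)
      | some b => Equiv.sigmaUnique (K (e₁ (.inr b))) (fun _ => Unit))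
    (optSigma.trans ((Equiv.sumCongr (Equiv.refl V) e₃).trans e₂)) ?_).trans ?_
  · rintro (_ | b) i x <;> rfl
  · congr 1
    funext o
    cases o with
    | none => exact (one_gcomp _ (Equiv.refl _) (fun _ => rfl) _).trans (P.map_refl _)
    | some b => exact (gcomp_one _ (Equiv.refl _) (fun _ => rfl) _).trans (P.map_refl _)

theorem ptc_insP {B C T S W V : Type} {K : T → Type} [Finite B] [Finite C] [Finite T] [Finite S]
    [Finite W] [Finite V] [∀ t, Finite (K t)] (e₁ : C ⊕ B ≃ T) (e : (Σ t, K t) ≃ S)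
    (e₃ : (Σ b, K (e₁ (.inr b))) ≃ W) (e₄ : (Σ c, K (e₁ (.inl c))) ≃ V) (e₂ : V ⊕ W ≃ S)
    (β : P.Op (Option B)) (θ : P.Op (Option C)) (ξ : ∀ t, P.Op (K t))
    (h₁ : ∀ c x, e₂ (.inl (e₄ ⟨c, x⟩)) = e ⟨e₁ (.inl c), x⟩)
    (h₂ : ∀ b x, e₂ (.inr (e₃ ⟨b, x⟩)) = e ⟨e₁ (.inr b), x⟩) :
    P.ptc e (P.insP e₁ β θ) ξ =
      P.insP e₂ (P.ptc e₃ β (fun b => ξ (e₁ (.inr b))))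
        (P.ptc e₄ θ (fun c => ξ (e₁ (.inl c)))) := by
  have E := gcomp_ins (P := P) (K := fun t : Option T => t.elim Unit K)
    (optSum.trans (Equiv.optionCongr e₁))
    (optSigma.trans ((Equiv.sumComm Unit _).trans
      ((Equiv.optionEquivSumPUnit _).symm.trans (Equiv.optionCongr e)))) e₃
    ((Equiv.sigmaCongrRight (fun i : Option C => match i with
          | none => Equiv.refl Unit
          | some c => Equiv.refl (K (e₁ (.inl c))))).trans
      (optSigma.trans ((Equiv.sumComm Unit _).trans
      ((Equiv.optionEquivSumPUnit _).symm.trans (Equiv.optionCongr e₄)))))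
    (optSum.trans (Equiv.optionCongr e₂)) β θ (P.optFam P.one ξ) ?_ ?_
  · refine E.trans ?_
    unfold insP
    refine congrArg (P.ins _ _) ?_
    refine gcomp_congr (J := Option C)
      (I' := fun o : Option C => o.elim Unit fun c => K (e₁ (.inl c)))
      _ _ _ _ _ (fun i => match i with
          | none => Equiv.refl Unit
          | some c => Equiv.refl (K (e₁ (.inl c)))) ?_ ?_
    · rintro (_ | b)
      · exact P.map_refl _
      · exact P.map_refl _
    · rintro (_ | b) x <;> rfl
  · rintro (_ | c) x
    · rfl
    · exact congrArg some (h₁ c x)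
  · rintro b x
    exact congrArg some (h₂ b x)

theorem ptc_ptc {A T S : Type} {I : A → Type} {K : T → Type} {M : A → Type} [Finite A]
    [∀ a, Finite (I a)] [Finite T] [∀ t, Finite (K t)] [Finite S] [∀ a, Finite (M a)]
    (e₁ : (Σ a, I a) ≃ T) (e : (Σ t, K t) ≃ S)
    (μ : P.Op (Option A)) (ν : ∀ a, P.Op (I a)) (ξ : ∀ t, P.Op (K t))
    (e₃ : ∀ a, (Σ i, K (e₁ ⟨a, i⟩)) ≃ M a) (e₂ : (Σ a, M a) ≃ S)
    (he : ∀ a i x, e₂ ⟨a, e₃ a ⟨i, x⟩⟩ = e ⟨e₁ ⟨a, i⟩, x⟩) :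
    P.ptc e (P.ptc e₁ μ ν) ξ =
      P.ptc e₂ μ (fun a => P.gcomp (e₃ a) (ν a) (fun i => ξ (e₁ ⟨a, i⟩))) := by
  unfold ptc
  refine (gcomp_assoc _ _ _ _ _ (M := fun o : Option A => o.elim Unit M)
    (fun o => match o with
      | none => Equiv.uniqueSigma (fun _ : Unit => Unit)
      | some a => e₃ a)
    (optSigma.trans ((Equiv.sumComm Unit _).trans
      ((Equiv.optionEquivSumPUnit _).symm.trans (Equiv.optionCongr e₂)))) ?_).trans ?_
  · rintro (_ | a) i x
    · rfl
    · exact congrArg some (he a i x)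
  · congr 1
    funext o
    cases o with
    | none => exact (one_gcomp _ (Equiv.refl _) (fun _ => rfl) _).trans (P.map_refl _)
    | some a => rfl

/-- Plugging the unit into the input `none` does nothing. -/
theorem insP_one {B C W : Type} [Finite B] [Finite C] [Finite W] (e : C ⊕ B ≃ W)
    (u : Unit ≃ Option C) (e' : B ≃ W) (h : ∀ b, e' b = e (.inr b)) (β : P.Op (Option B)) :
    P.insP e β (P.map u P.one) = P.map (Equiv.optionCongr e') β := by
  unfold insP ins
  refine (gcomp_congr (I' := fun _ : Option B => Unit) _
    ((Equiv.sigmaUnique (Option B) fun _ => Unit).trans (Equiv.optionCongr e')) _ _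
    (fun _ => P.one) (fun o => match o with
      | none => u.symm
      | some _ => Equiv.refl Unit) ?_ ?_).trans
    (gcomp_one _ (Equiv.optionCongr e') (fun _ => rfl) _)
  · rintro (_ | b)
    · refine (P.map_map u u.symm P.one).trans (map_eq_self _ (fun _ => rfl) _)
    · exact P.map_refl _
  · have : Subsingleton (Option C) := u.symm.subsingleton
    rintro (_ | b) x
    · obtain rfl : x = none := Subsingleton.elim (α := Option C) _ _
      rfl
    · exact congrArg some (h b)

theorem gcomp_map_one {J S : Type} {I : J → Type} [Finite J] [∀ j, Finite (I j)] [Finite S]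
    (e : (Σ j, I j) ≃ S) (u : ∀ j, Unit ≃ I j) (e' : J ≃ S) (h : ∀ j, e ⟨j, u j ()⟩ = e' j)
    (μ : P.Op J) : P.gcomp e μ (fun j => P.map (u j) P.one) = P.map e' μ := by
  refine (gcomp_congr _ ((Equiv.sigmaUnique J fun _ => Unit).trans e') _ _ (fun _ => P.one)
    (fun j => (u j).symm) (fun j => ?_) ?_).trans (gcomp_one _ e' (fun _ => rfl) _)
  · exact (P.map_map _ _ _).trans (map_eq_self _ (fun _ => rfl) _)
  · intro j x
    refine (h j).symm.trans (congrArg (fun y => e ⟨j, y⟩) ?_)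
    exact (u j).symm.injective rfl

theorem map_one_gcomp {J S : Type} {I : J → Type} [Finite J] [∀ j, Finite (I j)] [Finite S]
    (e : (Σ j, I j) ≃ S) (u : Unit ≃ J) (ν : ∀ j, P.Op (I j)) (j₀ : J) (e' : I j₀ ≃ S)
    (h : ∀ x, e ⟨j₀, x⟩ = e' x) :
    P.gcomp e (P.map u P.one) ν = P.map e' (ν j₀) := by
  obtain rfl : u () = j₀ := by
    obtain ⟨y, hy⟩ := u.surjective j₀
    exact hy
  rw [← one_gcomp ((Equiv.sigmaCongrLeft (β := I) u).trans e) e' h (ν (u ()))]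
  unfold gcomp
  rw [P.comp_map_left, P.map_map]

/-- Plugging an operation into the unit does nothing. -/
theorem one_ins {B C S : Type} [Finite B] [Finite C] [Finite S] (e : C ⊕ B ≃ S)
    (u : Unit ≃ Option B) (e' : C ≃ S) (h : ∀ c, e' c = e (.inl c)) (θ : P.Op C) :
    P.ins e (P.map u P.one) θ = P.map e' θ := by
  unfold ins
  exact map_one_gcomp (I := fun o : Option B => o.elim C fun _ => Unit) _ u _ none e'
    (fun x => (h x).symm)

theorem ptc_one {A S : Type} {I : A → Type} [Finite A] [∀ a, Finite (I a)] [Finite S]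
    (e : (Σ a, I a) ≃ S) (μ : P.Op (Option A)) (u : ∀ a, Unit ≃ I a) (e' : A ≃ S)
    (h : ∀ a, e' a = e ⟨a, u a ()⟩) :
    P.ptc e μ (fun a => P.map (u a) P.one) = P.map (Equiv.optionCongr e') μ := by
  unfold ptc
  refine (gcomp_congr (I' := fun _ : Option A => Unit) _
    ((Equiv.sigmaUnique (Option A) fun _ => Unit).trans (Equiv.optionCongr e')) _ _
    (fun _ => P.one) (fun o => match o with
      | none => Equiv.refl Unit
      | some a => (u a).symm) ?_ ?_).trans
    (gcomp_one _ (Equiv.optionCongr e') (fun _ => rfl) _)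
  · rintro (_ | b)
    · exact P.map_refl _
    · exact (P.map_map _ _ P.one).trans (map_eq_self _ (fun _ => rfl) _)
  · rintro (_ | b) x
    · rfl
    · refine congrArg some ((h b).trans (congrArg (fun y => e ⟨b, y⟩) ?_))
      exact (u b).symm.injective rfl

theorem one_ptc {A S : Type} {I : A → Type} [Finite A] [∀ a, Finite (I a)] [Finite S]
    (e : (Σ a, I a) ≃ S) (u : Unit ≃ Option A) (ν : ∀ a, P.Op (I a)) (u' : Unit ≃ Option S) :
    P.ptc e (P.map u P.one) ν = P.map u' P.one := by
  unfold ptc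
  refine map_one_gcomp (I := fun o : Option A => o.elim Unit I) _ u _ none u' (fun x => ?_)
  have : Subsingleton (Option S) := u'.symm.subsingleton
  exact Subsingleton.elim _ _

theorem ins_congr {B C C' S : Type} [Finite B] [Finite C] [Finite C'] [Finite S]
    (e : C ⊕ B ≃ S) (e' : C' ⊕ B ≃ S) (β : P.Op (Option B)) (θ : P.Op C) (θ' : P.Op C')
    (ε : C ≃ C') (hθ : P.map ε θ = θ') (h₁ : ∀ c, e' (.inl (ε c)) = e (.inl c))
    (h₂ : ∀ b, e' (.inr b) = e (.inr b)) :
    P.ins e β θ = P.ins e' β θ' := by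
  unfold ins
  refine gcomp_congr _ _ _ _ _ (fun o : Option B => match o with
    | none => ε
    | some _ => Equiv.refl Unit) ?_ ?_
  · rintro (_ | b)
    · exact hθ
    · exact P.map_refl _
  · rintro (_ | b) x
    · exact h₁ x
    · exact h₂ b

theorem insP_ptc {A B C C' W : Type} {I : A → Type} [Finite A] [∀ a, Finite (I a)] [Finite B]
    [Finite C] [Finite C'] [Finite W] (e : C ⊕ B ≃ W) (e' : C' ⊕ B ≃ W) (β : P.Op (Option B))
    (μ : P.Op (Option A)) (ν : ∀ a, P.Op (I a)) (e₁ : (Σ a, I a) ≃ C) (e₁' : (Σ a, I a) ≃ C')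
    (h₁ : ∀ x, e' (.inl (e₁' x)) = e (.inl (e₁ x))) (h₂ : ∀ b, e' (.inr b) = e (.inr b)) :
    P.insP e β (P.ptc e₁ μ ν) = P.insP e' β (P.ptc e₁' μ ν) := by
  refine ins_congr _ _ β _ _ (Equiv.optionCongr (e₁.symm.trans e₁')) ?_ ?_ ?_
  · unfold ptc
    rw [map_gcomp]
    refine gcomp_congr _ _ _ _ _ (fun _ => Equiv.refl _) (fun _ => P.map_refl _) ?_
    rintro (_ | a) x
    · rfl
    · exact (congrArg (fun y => some (e₁' y)) (e₁.symm_apply_apply ⟨a, x⟩)).symm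
  · rintro (_ | c)
    · rfl
    · refine congrArg some ((h₁ _).trans ?_)
      rw [e₁.apply_symm_apply]
  · intro b
    exact congrArg some (h₂ b)

theorem insP_insP {B C D S T W : Type} [Finite B] [Finite C] [Finite D] [Finite S] [Finite T]
    [Finite W] (e : T ⊕ D ≃ S) (e₁ : C ⊕ B ≃ T) (e₂ : C ⊕ W ≃ S) (e₃ : B ⊕ D ≃ W)
    (γ : P.Op (Option D)) (β : P.Op (Option B)) (θ : P.Op (Option C))
    (h₁ : ∀ c, e₂ (.inl c) = e (.inl (e₁ (.inl c))))
    (h₂ : ∀ b, e₂ (.inr (e₃ (.inl b))) = e (.inl (e₁ (.inr b))))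
    (h₃ : ∀ d, e₂ (.inr (e₃ (.inr d))) = e (.inr d)) :
    P.insP e γ (P.insP e₁ β θ) = P.insP e₂ (P.insP e₃ γ β) θ := by
  refine ins_ins _ _ _ e₃ γ β θ ?_ ?_ ?_
  · rintro (_ | c)
    · rfl
    · exact congrArg some (h₁ c)
  · exact fun b => congrArg some (h₂ b)
  · exact fun d => congrArg some (h₃ d)

end lemmas

end SymmOperad

/-! ## Finite pointed sets -/

/-- The category `Fin_*`: its objects are the finite pointed sets `⟨n⟩ = {0, 1, …, n}`. Here `⟨n⟩` is
`Option (Fin n)`, where `none` is the basepoint `0` and `some j` is the element `j + 1`. -/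
structure FinPtd where
  /-- The number of elements besides the basepoint. -/
  card : ℕ

namespace FinPtd

/-- Basepoint-preserving maps `⟨n⟩ → ⟨m⟩`. -/
@[ext]
structure Hom (X Y : FinPtd) where
  /-- The underlying map. -/
  toFun : Option (Fin X.card) → Option (Fin Y.card)
  map_none : toFun none = none

instance : Category FinPtd where
  Hom := Hom
  id _ := ⟨id, rfl⟩
  comp f g := ⟨g.toFun ∘ f.toFun, by simp [f.map_none, g.map_none]⟩

@[ext]
theorem hom_ext {X Y : FinPtd} {f g : X ⟶ Y} (h : ∀ x, f.toFun x = g.toFun x) : f = g :=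
  Hom.ext (funext h)

/-- The constant map to the basepoint. -/
def const (X Y : FinPtd) : X ⟶ Y := ⟨fun _ => none, rfl⟩

/-- The fibre of `f` over the element `some i`. -/
abbrev Fib {X Y : FinPtd} (f : X ⟶ Y) (i : Fin Y.card) : Type :=
  {j : Fin X.card // f.toFun (some j) = some i}

/-- The fibre of `f` over the basepoint, with the basepoint removed. -/
abbrev Fib₀ {X Y : FinPtd} (f : X ⟶ Y) : Type :=
  {j : Fin X.card // f.toFun (some j) = none}

section

variable {X Y Z : FinPtd} (g : X ⟶ Y) (f : Y ⟶ Z)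

/-- The fibre of `g ≫ f` over `some i` is the union of the fibres of `g` over the fibre of `f`. -/
noncomputable def fibComp (i : Fin Z.card) : (Σ j : Fib f i, Fib g j.1) ≃ Fib (g ≫ f) i :=
  Equiv.ofBijective
    (fun x => ⟨x.2.1, (congrArg f.toFun x.2.2).trans x.1.2⟩) (by
    constructor
    · rintro ⟨⟨j, hj⟩, ⟨k, hk⟩⟩ ⟨⟨j', hj'⟩, ⟨k', hk'⟩⟩ h
      obtain rfl : k = k' := congrArg Subtype.val h
      obtain rfl : j = j' := Option.some.inj (hk.symm.trans hk')
      rfl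
    · rintro ⟨k, hk⟩
      rcases h : g.toFun (some k) with _ | j
      · have : f.toFun (g.toFun (some k)) = some i := hk
        rw [h, f.map_none] at this
        cases this
      · exact ⟨⟨⟨j, (congrArg f.toFun h).symm.trans hk⟩, ⟨k, h⟩⟩, rfl⟩)

/-- The fibre of `g ≫ f` over the basepoint, with the basepoint removed, is the union of such a
fibre for `g` and of the fibres of `g` over such a fibre for `f`. -/
noncomputable def fibComp₀ : (Σ j : Fib₀ f, Fib g j.1) ⊕ Fib₀ g ≃ Fib₀ (g ≫ f) :=
  Equiv.ofBijective
    (fun x => match x with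
      | .inl x => ⟨x.2.1, (congrArg f.toFun x.2.2).trans x.1.2⟩
      | .inr k => ⟨k.1, (congrArg f.toFun k.2).trans f.map_none⟩) (by
    constructor
    · rintro (⟨⟨j, hj⟩, ⟨k, hk⟩⟩ | ⟨k, hk⟩) (⟨⟨j', hj'⟩, ⟨k', hk'⟩⟩ | ⟨k', hk'⟩) h
      · obtain rfl : k = k' := congrArg Subtype.val h
        obtain rfl : j = j' := Option.some.inj (hk.symm.trans hk')
        rfl
      · obtain rfl : k = k' := congrArg Subtype.val h
        cases hk.symm.trans hk'
      · obtain rfl : k = k' := congrArg Subtype.val h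
        cases hk.symm.trans hk'
      · obtain rfl : k = k' := congrArg Subtype.val h
        rfl
    · rintro ⟨k, hk⟩
      rcases h : g.toFun (some k) with _ | j
      · exact ⟨.inr ⟨k, h⟩, rfl⟩
      · exact ⟨.inl ⟨⟨j, (congrArg f.toFun h).symm.trans hk⟩, ⟨k, h⟩⟩, rfl⟩)

/-- The source of `g` is the union of its fibres. -/
noncomputable def fibAll : (Σ i : Fin Y.card, Fib g i) ⊕ Fib₀ g ≃ Fin X.card :=
  Equiv.ofBijective
    (fun x => match x with
      | .inl x => x.2.1
      | .inr k => k.1) (by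
    constructor
    · rintro (⟨j, ⟨k, hk⟩⟩ | ⟨k, hk⟩) (⟨j', ⟨k', hk'⟩⟩ | ⟨k', hk'⟩) h
      · obtain rfl : k = k' := h
        obtain rfl : j = j' := Option.some.inj (hk.symm.trans hk')
        rfl
      · obtain rfl : k = k' := h
        cases hk.symm.trans hk'
      · obtain rfl : k = k' := h
        cases hk.symm.trans hk'
      · obtain rfl : k = k' := h
        rfl
    · intro k
      rcases h : g.toFun (some k) with _ | j
      · exact ⟨.inr ⟨k, h⟩, rfl⟩
      · exact ⟨.inl ⟨j, ⟨k, h⟩⟩, rfl⟩)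

/-- The fibre of the identity over `some i` is a point. -/
def fibId (X : FinPtd) (i : Fin X.card) : Unit ≃ Fib (𝟙 X) i where
  toFun _ := ⟨i, rfl⟩
  invFun _ := ()
  left_inv _ := rfl
  right_inv := fun ⟨_, hj⟩ => Subtype.ext (Option.some.inj hj).symm

/-- The fibre of the identity over the basepoint is the basepoint. -/
def fibId₀ (X : FinPtd) : Unit ≃ Option (Fib₀ (𝟙 X)) where
  toFun _ := none
  invFun _ := ()
  left_inv _ := rfl
  right_inv
    | none => rfl
    | some ⟨_, hj⟩ => by cases hj

end

end FinPtd

/-! ## Infinitesimal bimodules and the twisted arrow category -/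

namespace SymmOperad

open FinPtd

/-- The category `Ib^P` that encodes infinitesimal bimodules over `P`. As `P` has a single colour,
its objects are the natural numbers. -/
structure Ib (P : SymmOperad) where
  /-- The number of inputs. -/
  arity : ℕ

namespace Ib

variable {P : SymmOperad}

/-- The finite pointed set of an object of `Ib^P`. -/
abbrev pt (x : Ib P) : FinPtd := ⟨x.arity⟩

/-- A morphism `m ⟶ n` of `Ib^P`: a map `f : ⟨n⟩ → ⟨m⟩` of finite pointed sets, an operation `α₀` with
inputs labelled by `f⁻¹(0)`, where the input labelled by the basepoint is the distinguished one,
and operations `α i` with inputs labelled by `f⁻¹(i)`, for `i = 1, …, m`. -/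
structure Hom (x y : Ib P) where
  /-- The map of finite pointed sets. -/
  base : y.pt ⟶ x.pt
  /-- The operation over the basepoint. -/
  zero : P.Op (Option (Fib₀ base))
  /-- The operations over the other elements. -/
  op : ∀ i, P.Op (Fib base i)

/-- The identity consists of unit operations. -/
def Hom.id (x : Ib P) : Hom x x where
  base := 𝟙 x.pt
  zero := P.map (fibId₀ x.pt) P.one
  op i := P.map (fibId x.pt i) P.one

/-- Composition: the operation over `i` is `α i ∘ (β j)_{j ∈ f⁻¹(i)}`, and the operation over the
basepoint is `β₀ ∘ (α₀ ∘ (β j)_{j ∈ f⁻¹(0), j ≠ 0})`, where the outer composition is at the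
distinguished input. -/
noncomputable def Hom.comp {x y z : Ib P} (α : Hom x y) (β : Hom y z) : Hom x z where
  base := β.base ≫ α.base
  zero := P.insP (fibComp₀ β.base α.base) β.zero
    (P.ptc (Equiv.refl _) α.zero (fun j => β.op j.1))
  op i := P.gcomp (fibComp β.base α.base i) (α.op i) (fun j => β.op j.1)

theorem Hom.mk_congr {x y : Ib P} {f : y.pt ⟶ x.pt} {a a' : P.Op (Option (Fib₀ f))}
    {b b' : ∀ i, P.Op (Fib f i)} (h : a = a') (h' : ∀ i, b i = b' i) :
    Hom.mk f a b = Hom.mk f a' b' := by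
  obtain rfl := h
  obtain rfl := funext h'
  rfl

section

variable {X Y Z W : FinPtd} (h : W ⟶ Z) (g : Z ⟶ Y) (f : Y ⟶ X)

theorem op_assoc (i : Fin X.card) (α : P.Op (Fib f i)) (β : ∀ j, P.Op (Fib g j))
    (γ : ∀ j, P.Op (Fib h j)) :
    P.gcomp (fibComp h (g ≫ f) i) (P.gcomp (fibComp g f i) α (fun j => β j.1)) (fun j => γ j.1) =
      P.gcomp (fibComp (h ≫ g) f i) α
        (fun j => P.gcomp (fibComp h g j.1) (β j.1) (fun j => γ j.1)) :=
  gcomp_assoc (fibComp g f i) (fibComp h (g ≫ f) i) α _ (fun j => γ j.1)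
    (fun j => fibComp h g j.1) _ (fun _ _ _ => rfl)

theorem zero_assoc (α₀ : P.Op (Option (Fib₀ f))) (β₀ : P.Op (Option (Fib₀ g)))
    (γ₀ : P.Op (Option (Fib₀ h))) (β : ∀ j, P.Op (Fib g j)) (γ : ∀ j, P.Op (Fib h j)) :
    P.insP (fibComp₀ h (g ≫ f)) γ₀ (P.ptc (Equiv.refl _)
        (P.insP (fibComp₀ g f) β₀ (P.ptc (Equiv.refl _) α₀ (fun j => β j.1))) (fun j => γ j.1)) =
      P.insP (fibComp₀ (h ≫ g) f)
        (P.insP (fibComp₀ h g) γ₀ (P.ptc (Equiv.refl _) β₀ (fun j => γ j.1)))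
        (P.ptc (Equiv.refl _) α₀
          (fun j => P.gcomp (fibComp h g j.1) (β j.1) (fun j => γ j.1))) := by
  let K : Fib₀ (g ≫ f) → Type := fun t => Fib h t.1
  let e₂ : (Σ c, K (fibComp₀ g f (.inl c))) ⊕ (Σ b, K (fibComp₀ g f (.inr b))) ≃ Σ t, K t :=
    (Equiv.sumSigmaDistrib (fun x => K (fibComp₀ g f x))).symm.trans
      (Equiv.sigmaCongrLeft (fibComp₀ g f))
  have E₁ := ptc_insP (P := P) (K := K) (fibComp₀ g f) (Equiv.refl _) (Equiv.refl _)
    (Equiv.refl _) e₂ β₀ (P.ptc (Equiv.refl _) α₀ (fun j => β j.1)) (fun j => γ j.1)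
    (fun _ _ => rfl) (fun _ _ => rfl)
  let e₃ : (Σ j : Fib₀ f, Fib (h ≫ g) j.1) ≃ Σ c, K (fibComp₀ g f (.inl c)) :=
    (Equiv.sigmaCongrRight (fun j : Fib₀ f => fibComp h g j.1)).symm.trans
      (Equiv.sigmaAssoc (fun (j : Fib₀ f) (k : Fib g j.1) => Fib h k.1)).symm
  have he₃ : ∀ j i x, e₃ ⟨j, fibComp h g j.1 ⟨i, x⟩⟩ = ⟨⟨j, i⟩, x⟩ := by
    intro j i x
    exact congrArg (Equiv.sigmaAssoc (fun (j : Fib₀ f) (k : Fib g j.1) => Fib h k.1)).symm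
      ((Equiv.sigmaCongrRight (fun j : Fib₀ f => fibComp h g j.1)).symm_apply_apply ⟨j, i, x⟩)
  have E₂ := ptc_ptc (P := P) (K := fun c => K (fibComp₀ g f (.inl c))) (Equiv.refl _)
    (Equiv.refl _) α₀ (fun j => β j.1) (fun c => γ c.2.1) (fun j => fibComp h g j.1) e₃ he₃
  rw [E₁]
  refine (congrArg (fun t => P.insP (fibComp₀ h (g ≫ f)) γ₀ (P.insP e₂ _ t)) E₂).trans ?_
  refine (insP_insP _ _ ((Equiv.sumCongr e₃.symm (Equiv.refl _)).trans (fibComp₀ (h ≫ g) f))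
    (fibComp₀ h g) _ _ _ ?_ ?_ ?_).trans ?_
  · rintro ⟨⟨j, k⟩, l⟩
    rfl
  · rintro ⟨k, l⟩
    rfl
  · intro l
    rfl
  · refine insP_ptc _ _ _ _ _ _ _ (fun x => ?_) (fun _ => rfl)
    exact congrArg (fun y => fibComp₀ (h ≫ g) f (.inl y)) (e₃.symm_apply_apply x).symm

end

noncomputable instance : Category (Ib P) where
  Hom := Hom
  id := Hom.id
  comp := Hom.comp
  id_comp := by
    rintro x y ⟨f, α₀, α⟩
    refine Hom.mk_congr (f := f) ?_ (fun i => ?_)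
    · have : IsEmpty (Fib₀ (𝟙 x.pt)) := ⟨fun j => by cases j.2⟩
      refine (congrArg (P.insP _ α₀) (one_ptc _ (fibId₀ x.pt) _ ?_)).trans ?_
      · exact (fibId₀ x.pt).trans (Equiv.optionCongr (@Equiv.equivOfIsEmpty _ _ this ⟨fun z => this.false z.1⟩))
      · refine (insP_one _ _ (Equiv.refl _) (fun b => rfl) _).trans (map_eq_self _ ?_ _)
        rintro (_ | _) <;> rfl
    · exact (map_one_gcomp _ (fibId x.pt i) _ ⟨i, rfl⟩ (Equiv.refl _) (fun _ => rfl)).trans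
        (P.map_refl _)
  comp_id := by
    rintro x y ⟨f, α₀, α⟩
    refine Hom.mk_congr (f := f) ?_ (fun i => ?_)
    · let e : Fib₀ f ≃ Σ j : Fib₀ f, Fib (𝟙 y.pt) j.1 :=
        (Equiv.sigmaUnique (Fib₀ f) (fun _ => Unit)).symm.trans
          (Equiv.sigmaCongrRight fun j => fibId y.pt j.1)
      refine (congrArg (P.insP _ _) (ptc_one _ α₀ (fun j => fibId y.pt j.1) e
        (fun _ => rfl))).trans ?_
      refine (one_ins _ (fibId₀ y.pt) (Equiv.optionCongr (e.symm)) ?_ _).trans ?_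
      · rintro (_ | ⟨j, ⟨k, hk⟩⟩)
        · rfl
        · obtain rfl : j.1 = k := (Option.some.inj hk).symm
          rfl
      · refine (P.map_map _ _ _).trans (map_eq_self _ ?_ _)
        rintro (_ | j) <;> rfl
    · refine (gcomp_congr (J := Fib f i) _ (Equiv.sigmaUnique _ (fun _ => Unit)) _ _
        (fun _ => P.one) (fun j : Fib f i => (fibId y.pt j.1).symm) (fun j => ?_) ?_).trans (P.comp_one _)
      · exact (P.map_map _ _ _).trans (map_eq_self _ (fun _ => rfl) _)
      · rintro j ⟨k, hk⟩
        exact Subtype.ext (Option.some.inj hk).symm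
  assoc := by
    rintro x y z w ⟨f, α₀, α⟩ ⟨g, β₀, β⟩ ⟨h, γ₀, γ⟩
    exact Hom.mk_congr (f := h ≫ g ≫ f) (zero_assoc h g f α₀ β₀ γ₀ β γ)
      (fun i => op_assoc h g f i (α i) β γ)

end Ib
end SymmOperad

namespace SymmOperad

open FinPtd

section

variable (P : SymmOperad)

/-- The map `α^* : P(m) → P(n)` of a morphism `α : m ⟶ n` of `Ib^P`. It sends `θ` to
`α₀ ∘₁ θ ∘ (α 1, …, α m)`, with the inputs relabelled by `1, …, n`. -/
noncomputable def act {P : SymmOperad} {x y : Ib P} (α : Ib.Hom x y) (θ : P.Op (Fin x.arity)) :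
    P.Op (Fin y.arity) :=
  P.ins (fibAll α.base) α.zero (P.gcomp (Equiv.refl _) θ α.op)

theorem act_id (x : Ib P) (θ : P.Op (Fin x.arity)) : act (𝟙 x : x ⟶ x) θ = θ := by
  let e : Fin x.arity ≃ Σ i, Fib (𝟙 x.pt) i :=
    (Equiv.sigmaUnique (Fin x.arity) (fun _ => Unit)).symm.trans
      (Equiv.sigmaCongrRight fun i => fibId x.pt i)
  refine (congrArg (P.ins (fibAll (𝟙 x.pt)) _)
    (gcomp_map_one (Equiv.refl _) (fibId x.pt) e (fun _ => rfl) θ)).trans ?_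
  refine (one_ins _ (fibId₀ x.pt) e.symm ?_ _).trans ?_
  · rintro ⟨i, ⟨j, hj⟩⟩
    exact Option.some.inj hj.symm
  · exact (P.map_map _ _ _).trans (map_eq_self _ (fun _ => e.symm_apply_apply _) _)

theorem act_comp {x y z : Ib P} (α : x ⟶ y) (β : y ⟶ z) (θ : P.Op (Fin x.arity)) :
    act (α ≫ β) θ = act β (act α θ) := by
  obtain ⟨f, α₀, α⟩ := α
  obtain ⟨g, β₀, β⟩ := β
  let K : Fin y.arity → Type := Fib g
  let e₂ : (Σ c, K (fibAll f (.inl c))) ⊕ (Σ b, K (fibAll f (.inr b))) ≃ Σ t, K t :=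
    (Equiv.sumSigmaDistrib (fun x => K (fibAll f x))).symm.trans (Equiv.sigmaCongrLeft (fibAll f))
  have E₁ := gcomp_ins (P := P) (K := K) (fibAll f) (Equiv.refl _) (Equiv.refl _)
    (Equiv.refl _) e₂ α₀ (P.gcomp (Equiv.refl _) θ α) β (fun _ _ => rfl) (fun _ _ => rfl)
  let e₃ : (Σ i, Fib (g ≫ f) i) ≃ Σ c, K (fibAll f (.inl c)) :=
    (Equiv.sigmaCongrRight (fun i => fibComp g f i)).symm.trans
      (Equiv.sigmaAssoc (fun (i : Fin x.arity) (k : Fib f i) => Fib g k.1)).symm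
  have he₃ : ∀ j i x, e₃ ⟨j, fibComp g f j ⟨i, x⟩⟩ = ⟨⟨j, i⟩, x⟩ := by
    intro j i x
    exact congrArg (Equiv.sigmaAssoc (fun (j : Fin _) (k : Fib f j) => Fib g k.1)).symm
      ((Equiv.sigmaCongrRight (fun i => fibComp g f i)).symm_apply_apply ⟨j, i, x⟩)
  have E₂ := gcomp_assoc (P := P) (K := fun c => K (fibAll f (.inl c))) (Equiv.refl _)
    (Equiv.refl _) θ α (fun c => β c.2.1) (fun i => fibComp g f i) e₃ he₃
  symm
  refine (congrArg (P.ins (fibAll g) β₀) E₁).trans ?_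
  refine (congrArg (fun t => P.ins (fibAll g) β₀ (P.ins e₂ _ t)) E₂).trans ?_
  refine (ins_ins _ _ ((Equiv.sumCongr e₃.symm (Equiv.refl _)).trans (fibAll (g ≫ f)))
    (fibComp₀ g f) _ _ _ ?_ ?_ ?_).trans ?_
  · rintro ⟨⟨j, k⟩, l⟩
    rfl
  · rintro ⟨k, l⟩
    rfl
  · intro l
    rfl
  · refine ins_congr _ _ _ _ _ e₃.symm ?_ (fun _ => rfl) (fun _ => rfl)
    refine (map_gcomp _ _ _ _).trans ?_
    refine congrArg (fun e => P.gcomp e θ _) ?_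
    exact e₃.self_trans_symm

/-- The operad `P` as an infinitesimal bimodule over itself, that is, as a functor on `Ib^P`. -/
noncomputable def selfBimodule : Ib P ⥤ Type where
  obj x := P.Op (Fin x.arity)
  map α := TypeCat.ofHom (act α)
  map_id x := by
    ext θ
    exact act_id P x θ
  map_comp {x y z} α β := by
    ext θ
    exact act_comp P α β θ

/-- The twisted arrow category of `P`: the category of elements (the covariant unstraightening) of
`P : Ib^P ⥤ Type`. Its objects are the operations of `P`, and a morphism `μ ⟶ ν` is a morphism `α` of
`Ib^P` between the arities such that `α^* μ = ν`. -/
abbrev Tw : Type := P.selfBimodule.Elements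

end

end SymmOperad

/-! ## The associative operad -/

/-- A strict total order on `S`. -/
@[ext]
structure StrictOrd (S : Type) where
  /-- The relation. -/
  lt : S → S → Prop
  irrefl : ∀ x, ¬ lt x x
  trans : ∀ x y z, lt x y → lt y z → lt x z
  tri : ∀ x y, lt x y ∨ x = y ∨ lt y x

namespace StrictOrd

/-- The order on `S` induced by an injective map to `T`. -/
def comap {S T : Type} (r : StrictOrd T) (f : S → T) (hf : Function.Injective f) :
    StrictOrd S where
  lt x y := r.lt (f x) (f y)
  irrefl x := r.irrefl _
  trans _ _ _ := r.trans _ _ _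
  tri x y := by
    rcases r.tri (f x) (f y) with h | h | h
    · exact .inl h
    · exact .inr (.inl (hf h))
    · exact .inr (.inr h)

/-- The concatenation of the orders `s j` along the order `r`. -/
def sigma {J : Type} {I : J → Type} (r : StrictOrd J) (s : ∀ j, StrictOrd (I j)) :
    StrictOrd (Σ j, I j) where
  lt := Sigma.Lex r.lt (fun j => (s j).lt)
  irrefl := by
    rintro ⟨j, x⟩ h
    rcases Sigma.lex_iff.1 h with h | ⟨_, h⟩
    · exact r.irrefl _ h
    · exact (s j).irrefl _ h
  trans := by
    rintro _ _ _ (⟨a, b, h⟩ | ⟨a, b, h⟩) h'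
    · rcases h' with ⟨_, _, h'⟩ | ⟨_, _, h'⟩
      · exact .left _ _ (r.trans _ _ _ h h')
      · exact .left _ _ h
    · rcases h' with ⟨_, _, h'⟩ | ⟨_, _, h'⟩
      · exact .left _ _ h'
      · exact .right _ _ ((s _).trans _ _ _ h h')
  tri := by
    rintro ⟨j, x⟩ ⟨k, y⟩
    rcases r.tri j k with h | rfl | h
    · exact .inl (.left _ _ h)
    · rcases (s j).tri x y with h | rfl | h
      · exact .inl (.right _ _ h)
      · exact .inr (.inl rfl)
      · exact .inr (.inr (.right _ _ h))
    · exact .inr (.inr (.left _ _ h))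

theorem sigma_lt {J : Type} {I : J → Type} (r : StrictOrd J) (s : ∀ j, StrictOrd (I j)) (j k : J)
    (x : I j) (y : I k) :
    (r.sigma s).lt ⟨j, x⟩ ⟨k, y⟩ ↔ r.lt j k ∨ ∃ h : j = k, (s k).lt (h ▸ x) y :=
  Sigma.lex_iff

theorem sigma_lt_same {J : Type} {I : J → Type} (r : StrictOrd J) (s : ∀ j, StrictOrd (I j))
    (j : J) (x y : I j) : (r.sigma s).lt ⟨j, x⟩ ⟨j, y⟩ ↔ (s j).lt x y := by
  rw [sigma_lt]
  constructor
  · rintro (h | ⟨_, h⟩)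
    · exact (r.irrefl _ h).elim
    · exact h
  · exact fun h => .inr ⟨rfl, h⟩

theorem sigma_lt_ne {J : Type} {I : J → Type} (r : StrictOrd J) (s : ∀ j, StrictOrd (I j))
    {j k : J} (hjk : j ≠ k) (x : I j) (y : I k) :
    (r.sigma s).lt ⟨j, x⟩ ⟨k, y⟩ ↔ r.lt j k := by
  rw [sigma_lt]
  constructor
  · rintro (h | ⟨h, _⟩)
    · exact h
    · exact (hjk h).elim
  · exact .inl

end StrictOrd

/-- The associative operad. Its operations with inputs labelled by `S` are the total orders on `S`,
and its composition is the concatenation of orders. -/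
def Ass : SymmOperad where
  Op S := StrictOrd S
  map e r := r.comap e.symm e.symm.injective
  one := ⟨fun _ _ => False, fun _ => id, fun _ _ _ h => h.elim, fun _ _ => .inr (.inl rfl)⟩
  comp r s := r.sigma s
  map_refl _ := rfl
  map_map _ _ _ := rfl
  comp_map_left {J J' I} _ _ _ e μ ν := by
    refine StrictOrd.ext (funext fun x => funext fun y => propext ?_)
    obtain ⟨⟨j, x⟩, rfl⟩ := (Equiv.sigmaCongrLeft (β := I) e).surjective x
    obtain ⟨⟨k, y⟩, rfl⟩ := (Equiv.sigmaCongrLeft (β := I) e).surjective y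
    simp only [StrictOrd.comap, Equiv.symm_apply_apply]
    simp only [Equiv.sigmaCongrLeft_apply]
    by_cases h : j = k
    · obtain rfl := h
      rw [StrictOrd.sigma_lt_same, StrictOrd.sigma_lt_same]
    · rw [StrictOrd.sigma_lt_ne _ _ h,
        StrictOrd.sigma_lt_ne _ _ (fun h' => h (e.injective h'))]
      simp
  comp_map_right e μ ν := by
    refine StrictOrd.ext (funext fun x => funext fun y => propext ?_)
    obtain ⟨⟨j, x⟩, rfl⟩ := (Equiv.sigmaCongrRight e).surjective x
    obtain ⟨⟨k, y⟩, rfl⟩ := (Equiv.sigmaCongrRight e).surjective y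
    simp only [StrictOrd.comap, Equiv.symm_apply_apply]
    simp only [Equiv.sigmaCongrRight_apply]
    by_cases h : j = k
    · obtain rfl := h
      rw [StrictOrd.sigma_lt_same, StrictOrd.sigma_lt_same]
      simp
    · rw [StrictOrd.sigma_lt_ne _ _ h, StrictOrd.sigma_lt_ne _ _ h]
  comp_assoc μ ν ξ := by
    refine StrictOrd.ext (funext fun x => funext fun y => propext ?_)
    obtain ⟨j, ⟨i, x⟩⟩ := x
    obtain ⟨j', ⟨i', x'⟩⟩ := y
    change (((μ.sigma ν).sigma fun x => ξ x.1 x.2).lt ⟨⟨j, i⟩, x⟩ ⟨⟨j', i'⟩, x'⟩) ↔ _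
    by_cases h : j = j'
    · obtain rfl := h
      rw [StrictOrd.sigma_lt_same]
      by_cases h : i = i'
      · obtain rfl := h
        rw [StrictOrd.sigma_lt_same, StrictOrd.sigma_lt_same]
      · rw [StrictOrd.sigma_lt_ne _ _ h, StrictOrd.sigma_lt_ne, StrictOrd.sigma_lt_same]
        rintro ⟨⟩
        exact h rfl
    · rw [StrictOrd.sigma_lt_ne _ _ h, StrictOrd.sigma_lt_ne, StrictOrd.sigma_lt_ne _ _ h]
      rintro ⟨⟩
      exact h rfl
  one_comp μ := by
    ext x y
    exact StrictOrd.sigma_lt_same _ _ _ _ _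
  comp_one μ := by
    ext x y
    refine (StrictOrd.sigma_lt _ _ _ _ _ _).trans ?_
    exact ⟨fun h => h.resolve_right fun h => h.2, .inl⟩

namespace Ass

/-- The operation of the permutation `σ = [σ(1), …, σ(n)]`: its `k`-th input has position `σ(k)`. -/
def ofPerm {n : ℕ} (σ : Equiv.Perm (Fin n)) : Ass.Op (Fin n) where
  lt j k := σ j < σ k
  irrefl _ := lt_irrefl _
  trans _ _ _ := lt_trans
  tri j k := by
    rcases lt_trichotomy (σ j) (σ k) with h | h | h
    · exact .inl h
    · exact .inr (.inl (σ.injective h))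
    · exact .inr (.inr h)

/-- The set of `n`-ary operations of `Ass` is `Σ_n`. -/
theorem ofPerm_bijective (n : ℕ) : Function.Bijective (ofPerm (n := n)) := by
  constructor
  · intro σ τ h
    have h' : ∀ j k, σ j < σ k ↔ τ j < τ k := fun j k =>
      iff_of_eq (congrFun (congrFun (congrArg StrictOrd.lt h) j) k)
    have hm : StrictMono (τ ∘ σ.symm) := fun j k hjk => (h' _ _).1 (by simpa using hjk)
    have : OrderIso.refl (Fin n) = ⟨σ.symm.trans τ, hm.le_iff_le⟩ := Subsingleton.elim _ _
    ext j
    have h₂ : (σ j : ℕ) = (τ (σ.symm (σ j)) : ℕ) :=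
      congrArg (fun e : Fin n ≃o Fin n => (e (σ j) : ℕ)) this
    rwa [σ.symm_apply_apply] at h₂
  · intro r
    classical
    let pos : Fin n → ℕ := fun j => (Finset.univ.filter fun i => r.lt i j).card
    have hpos : ∀ j k, r.lt j k → pos j < pos k := fun j k h => by
      refine Finset.card_lt_card ⟨fun i hi => ?_, fun h' => ?_⟩
      · simp only [Finset.mem_filter, Finset.mem_univ, true_and] at hi ⊢
        exact r.trans _ _ _ hi h
      · have : j ∈ Finset.univ.filter fun i => r.lt i j := h' (by simpa using h)
        exact r.irrefl j (by simpa using this)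
    have hlt : ∀ j, pos j < n := fun j => by
      refine (Finset.card_lt_univ_of_notMem (x := j) ?_).trans_eq (Fintype.card_fin n)
      simpa using r.irrefl j
    have hinj : Function.Injective fun j => (⟨pos j, hlt j⟩ : Fin n) := by
      intro j k h
      have h : pos j = pos k := congrArg Fin.val h
      rcases r.tri j k with h' | h' | h'
      · exact absurd h (hpos _ _ h').ne
      · exact h'
      · exact absurd h (hpos _ _ h').ne'
    refine ⟨Equiv.ofBijective _ (Finite.injective_iff_bijective.1 hinj), ?_⟩
    refine StrictOrd.ext (funext fun j => funext fun k => propext ⟨fun h => ?_, hpos j k⟩)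
    have h : pos j < pos k := h
    rcases r.tri j k with h' | h' | h'
    · exact h'
    · obtain rfl := h'
      exact absurd h (lt_irrefl _)
    · exact absurd h (hpos _ _ h').le.not_gt

/-- The right action of `Σ_n` on the `n`-ary operations of `Ass` is the right multiplication. -/
theorem map_ofPerm {n : ℕ} (σ ρ : Equiv.Perm (Fin n)) :
    Ass.map σ⁻¹ (ofPerm ρ) = ofPerm (ρ * σ) := rfl

/-- The identity permutation `μ_n ∈ Σ_n`, as an object of `Tw(Ass)`. -/
noncomputable def mu (n : ℕ) : SymmOperad.Tw Ass := ⟨⟨n⟩, ofPerm 1⟩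

theorem gcomp_lt {J S : Type} {I : J → Type} [Finite J] [∀ j, Finite (I j)] [Finite S]
    (e : (Σ j, I j) ≃ S) (μ : Ass.Op J) (ν : ∀ j, Ass.Op (I j)) (x y : Σ j, I j) :
    (Ass.gcomp e μ ν).lt (e x) (e y) ↔ (StrictOrd.sigma μ ν).lt x y := by
  change (StrictOrd.sigma μ ν).lt (e.symm (e x)) (e.symm (e y)) ↔ _
  rw [e.symm_apply_apply, e.symm_apply_apply]

open FinPtd in
/-- All elements but the basepoint lie in the fibre of the constant map over the basepoint. -/
def fib₀Const (X Y : FinPtd) : Option (Fin X.card) ≃ Option (Fib₀ (FinPtd.const X Y)) :=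
  Equiv.optionCongr (Equiv.subtypeUnivEquiv fun _ => rfl).symm

/-- The permutation `[i + 1, 1, …, i, i + 2, …, n + 1] ∈ Σ_(n + 1)`, for `i = 0, …, n`. (In the
code, elements are counted from `0`.) -/
def movePerm {n : ℕ} (i : Fin (n + 1)) : Equiv.Perm (Fin (n + 1)) := i.cycleRange.symm

theorem movePerm_zero {n : ℕ} (i : Fin (n + 1)) : movePerm i 0 = i := by simp [movePerm]

theorem movePerm_succ {n : ℕ} (i : Fin (n + 1)) (j : Fin n) :
    movePerm i j.succ = if (j : ℕ) < i then j.castSucc else j.succ := by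
  simp only [movePerm, Fin.cycleRange_symm_succ, Fin.succAbove, Fin.lt_def, Fin.val_castSucc]

/-- The morphism `m ⟶ n` of `Ib^Ass` over the constant map `⟨n⟩ → ⟨m⟩` whose operation over the
basepoint is given by the permutation `[i + 1, 1, …, i, i + 2, …, n + 1]`. Its other operations
have no inputs. -/
def ibConst (m n : ℕ) (i : Fin (n + 1)) : SymmOperad.Ib.Hom (P := Ass) ⟨m⟩ ⟨n⟩ where
  base := FinPtd.const _ _
  zero := Ass.map ((finSuccEquiv n).trans (fib₀Const ⟨n⟩ ⟨m⟩)) (ofPerm (movePerm i))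
  op _ := ⟨fun _ _ => False, fun _ => id, fun _ _ _ h => h.elim,
    fun x _ => (Option.some_ne_none _ x.2.symm).elim⟩

/-- The morphism of `Ib^Ass` above, as a morphism `μ_m ⟶ μ_n` of `Tw(Ass)`. -/
noncomputable def constHom (m n : ℕ) (i : Fin (n + 1)) : mu m ⟶ mu n :=
  ⟨ibConst m n i, by
    refine StrictOrd.ext (funext fun x => funext fun y => propext ?_)
    obtain ⟨x | x, rfl⟩ := (FinPtd.fibAll (ibConst m n i).base).surjective x
    · exact (Option.some_ne_none _ x.2.2.symm).elim
    obtain ⟨y | y, rfl⟩ := (FinPtd.fibAll (ibConst m n i).base).surjective y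
    · exact (Option.some_ne_none _ y.2.2.symm).elim
    refine (gcomp_lt (I := fun o => Option.elim o _ fun _ => Unit) _ _ _
      ⟨some x, ()⟩ ⟨some y, ()⟩).trans ?_
    refine (StrictOrd.sigma_lt _ _ _ _ _ _).trans ?_
    refine Iff.trans ⟨fun h => h.resolve_right fun h => h.2, .inl⟩ ?_
    change movePerm i x.1.succ < movePerm i y.1.succ ↔ x.1 < y.1
    simp only [movePerm, Fin.cycleRange_symm_succ]
    exact (Fin.strictMono_succAbove i).lt_iff_lt⟩

end Ass

/-! ## The functor `ι : Δ → Fin_*^op` -/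

/-- For a monotone map `f : [m] → [n]`, the map `ι(f) : ⟨n⟩ → ⟨m⟩` sends `j ∈ {1, …, n}` to the unique
`i ∈ {1, …, m}` with `f (i - 1) < j ≤ f i`, if there is one, and to the basepoint otherwise. (In the
code, `some j` stands for `j + 1`.) -/
noncomputable def iotaFun {m n : ℕ} (f : Fin (m + 1) →o Fin (n + 1)) :
    Option (Fin n) → Option (Fin m)
  | none => none
  | some j =>
    open Classical in
    if h : ∃ i : Fin m, (f i.castSucc : ℕ) < j + 1 ∧ (j : ℕ) + 1 ≤ f i.succ then some h.choose
    else none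

theorem iotaFun_eq_some {m n : ℕ} (f : Fin (m + 1) →o Fin (n + 1)) (j : Fin n) (i : Fin m) :
    iotaFun f (some j) = some i ↔ (f i.castSucc : ℕ) < j + 1 ∧ (j : ℕ) + 1 ≤ f i.succ := by
  simp only [iotaFun]
  split_ifs with h
  · have hc := h.choose_spec
    refine ⟨fun hi => Option.some.inj hi ▸ hc, fun hi => congrArg some ?_⟩
    rcases lt_trichotomy h.choose i with hlt | heq | hlt
    · have : f h.choose.succ ≤ f i.castSucc := f.monotone (by simpa [Fin.le_def] using hlt)
      have := Fin.le_def.1 this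
      omega
    · exact heq
    · have : f i.succ ≤ f h.choose.castSucc := f.monotone (by simpa [Fin.le_def] using hlt)
      have := Fin.le_def.1 this
      omega
  · exact ⟨fun h' => (nomatch h'), fun h' => (h ⟨i, h'⟩).elim⟩

theorem exists_step {m : ℕ} (f : Fin (m + 1) → ℕ) (j : ℕ) (a b : Fin (m + 1)) (hab : a ≤ b)
    (ha : f a < j) (hb : j ≤ f b) :
    ∃ i : Fin m, a ≤ i.castSucc ∧ i.succ ≤ b ∧ f i.castSucc < j ∧ j ≤ f i.succ := by
  induction b using Fin.induction with
  | zero =>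
    obtain rfl : a = 0 := Fin.le_zero_iff.1 hab
    omega
  | succ b ih =>
    rcases hab.lt_or_eq with h | rfl
    · by_cases hb' : j ≤ f b.castSucc
      · obtain ⟨i, h₁, h₂, h₃⟩ := ih (Fin.le_castSucc_iff.2 h) hb'
        exact ⟨i, h₁, h₂.trans (Fin.castSucc_le_succ b), h₃⟩
      · exact ⟨b, Fin.le_castSucc_iff.2 h, le_rfl, by omega, hb⟩
    · omega

/-- The functor `ι : Δ → Fin_*^op`. -/
noncomputable def iota : SimplexCategory ⥤ FinPtdᵒᵖ where
  obj X := Opposite.op ⟨X.len⟩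
  map {X Y} f := Quiver.Hom.op
    (show (⟨Y.len⟩ : FinPtd) ⟶ ⟨X.len⟩ from ⟨iotaFun f.toOrderHom, rfl⟩)
  map_id X := by
    refine congrArg Quiver.Hom.op (FinPtd.hom_ext ?_)
    rintro (_ | j)
    · rfl
    · refine (iotaFun_eq_some _ j j).2 ?_
      simp
  map_comp {X Y Z} f g := by
    refine congrArg Quiver.Hom.op (FinPtd.hom_ext ?_)
    rintro (_ | j)
    · rfl
    · refine Option.ext fun i => ?_
      change iotaFun _ (some j) = some i ↔ iotaFun _ (iotaFun _ (some j)) = some i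
      rw [iotaFun_eq_some]
      constructor
      · rintro ⟨h₁, h₂⟩
        obtain ⟨k, k₁, k₂, k₃⟩ := exists_step (fun k => (g.toOrderHom k : ℕ)) (j + 1)
          (f.toOrderHom i.castSucc) (f.toOrderHom i.succ)
          (f.toOrderHom.monotone (Fin.castSucc_le_succ i)) h₁ h₂
        rw [(iotaFun_eq_some g.toOrderHom j k).2 k₃, iotaFun_eq_some]
        have k₁ := Fin.le_def.1 k₁
        have k₂ := Fin.le_def.1 k₂
        simp only [Fin.val_castSucc, Fin.val_succ] at k₁ k₂
        omega
      · intro h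
        rcases hk : iotaFun g.toOrderHom (some j) with _ | k
        · rw [hk] at h
          cases h
        · rw [hk, iotaFun_eq_some] at h
          rw [iotaFun_eq_some] at hk
          have h₁ : f.toOrderHom i.castSucc ≤ k.castSucc := Fin.le_def.2 (by
            simp only [Fin.val_castSucc]; omega)
          have h₂ : k.succ ≤ f.toOrderHom i.succ := Fin.le_def.2 (by
            simp only [Fin.val_succ]; omega)
          have h₁ := Fin.le_def.1 (g.toOrderHom.monotone h₁)
          have h₂ := Fin.le_def.1 (g.toOrderHom.monotone h₂)
          change (g.toOrderHom (f.toOrderHom i.castSucc) : ℕ) < j + 1 ∧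
            (j : ℕ) + 1 ≤ g.toOrderHom (f.toOrderHom i.succ)
          omega

namespace Ass

/-- The map `ι_(m, n) : Hom_Δ([m], [n]) → Hom_(Fin_*)(⟨n⟩, ⟨m⟩)`. -/
noncomputable def iotaHom (m n : ℕ) (f : SimplexCategory.mk m ⟶ SimplexCategory.mk n) :
    (⟨n⟩ : FinPtd) ⟶ ⟨m⟩ :=
  (iota.map f).unop

/-- The map `⟨n⟩ → ⟨m⟩` of finite pointed sets that underlies a morphism `μ_m ⟶ μ_n` of
`Tw(Ass)`. -/
noncomputable def base {m n : ℕ} (h : mu m ⟶ mu n) : (⟨n⟩ : FinPtd) ⟶ ⟨m⟩ :=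
  SymmOperad.Ib.Hom.base h.1

/-- The constant maps `[m] → [n]`. -/
def constMaps (m n : ℕ) : Set (SimplexCategory.mk m ⟶ SimplexCategory.mk n) :=
  Set.range fun i : Fin (n + 1) => SimplexCategory.const _ _ i

/-- The map `Hom_Δ([m], [n]) → Hom_(Tw(Ass))(μ_m, μ_n)` induced by a functor that sends `[n]` to `μ_n`
for all `n`. -/
noncomputable def homMap (φ : SimplexCategory ⥤ SymmOperad.Tw Ass)
    (hφ : ∀ n, φ.obj (SimplexCategory.mk n) = mu n) (m n : ℕ)
    (f : SimplexCategory.mk m ⟶ SimplexCategory.mk n) : mu m ⟶ mu n :=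
  eqToHom (hφ m).symm ≫ φ.map f ≫ eqToHom (hφ n)

end Ass

/-! A morphism `μ ⟶ ν` of `Tw(Ass)` consists of a pointed map `f` and linear orders whose
substitution into `μ` gives the order `ν`. This equation forces every `α i`, and also `α₀` away from
its distinguished input, to be a restriction of `ν`. The only datum besides `f` is therefore the
place of the distinguished input, that is, the set `Before` of inputs over the basepoint that
precede it (`tw_hom_ext`).

For `μ = μ_m` and `ν = μ_n` the equation says that `1 < … < n` is the concatenation of the inputs in
`Before`, the fibres over `1, …, m`, and the remaining inputs over the basepoint. Such a division
into `m + 2` consecutive, possibly empty blocks is the same as `m + 1` cut points `c 0 ≤ … ≤ c m` in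
`{0, …, n}`, hence a monotone map `c : [m] → [n]`. The fibre over `i` is the interval `(c (i - 1), c
i]`, so `f = ι(c)`, and `Before` consists of the elements up to `c 0`. `deltaHom` builds the
morphism from the cuts, and `deltaHom_surjective` reads the cuts off a morphism. Functoriality holds
because `Before` of a composite (`before_comp`) obeys the same rule as the elements below a value of
a monotone map (`lt_toOrderHom_iff`). As every linear order on `n` inputs is isomorphic to the
standard one, the functor is an equivalence.

If some middle block is nonempty, any element of it separates the first block from the last, so
`ι(c)` alone determines `c`. If all middle blocks are empty, only the value `c 0` is left, with `n +
1` choices. -/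

namespace Ass

open SymmOperad FinPtd

/-! ### The order obtained by substitution -/

section act

variable {x y : Ib Ass} (α : Ib.Hom x y) (θ : Ass.Op (Fin x.arity))

/-- The order `act α θ` is `α.zero` with the concatenation of the fibres along `θ` inserted at
`none`. Two inputs are thus compared at the outermost level at which they lie in different blocks.
This lemma and the next four treat the possible positions of the two inputs. -/
theorem act_lt_of_fib₀_of_fib₀ (j k : Fib₀ α.base) :
    (act α θ).lt j.1 k.1 ↔ α.zero.lt (some j) (some k) := by
  refine (gcomp_lt
    (I := fun o : Option (Fib₀ α.base) => Option.elim o (Σ i, Fib α.base i) fun _ => Unit)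
    _ _ _ ⟨some j, ()⟩ ⟨some k, ()⟩).trans
    ((StrictOrd.sigma_lt _ _ _ _ _ _).trans ?_)
  -- The block of `some j` is a single input with the empty order, so only the outer comparison can
  -- hold.
  exact ⟨fun h => h.resolve_right fun h => h.2, .inl⟩

theorem act_lt_of_fib₀_of_fib (j : Fib₀ α.base) {i : Fin x.arity} (k : Fib α.base i) :
    (act α θ).lt j.1 k.1 ↔ α.zero.lt (some j) none := by
  refine (gcomp_lt
    (I := fun o : Option (Fib₀ α.base) => Option.elim o (Σ i, Fib α.base i) fun _ => Unit)
    _ _ _ ⟨some j, ()⟩ ⟨none, ⟨i, k⟩⟩).trans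
    (StrictOrd.sigma_lt_ne _ _ (by simp) _ _)

theorem act_lt_of_fib_of_fib₀ {i : Fin x.arity} (j : Fib α.base i) (k : Fib₀ α.base) :
    (act α θ).lt j.1 k.1 ↔ α.zero.lt none (some k) := by
  refine (gcomp_lt
    (I := fun o : Option (Fib₀ α.base) => Option.elim o (Σ i, Fib α.base i) fun _ => Unit)
    _ _ _ ⟨none, ⟨i, j⟩⟩ ⟨some k, ()⟩).trans
    (StrictOrd.sigma_lt_ne _ _ (by simp) _ _)

theorem act_lt_of_fib {i : Fin x.arity} (j k : Fib α.base i) :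
    (act α θ).lt j.1 k.1 ↔ (α.op i).lt j k := by
  refine (gcomp_lt
    (I := fun o : Option (Fib₀ α.base) => Option.elim o (Σ i, Fib α.base i) fun _ => Unit)
    _ _ _ ⟨none, ⟨i, j⟩⟩ ⟨none, ⟨i, k⟩⟩).trans
    ((StrictOrd.sigma_lt_same _ _ _ _ _).trans ?_)
  exact StrictOrd.sigma_lt_same _ _ _ _ _

theorem act_lt_of_fib_ne {i i' : Fin x.arity} (hi : i ≠ i') (j : Fib α.base i)
    (k : Fib α.base i') : (act α θ).lt j.1 k.1 ↔ θ.lt i i' := by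
  refine (gcomp_lt
    (I := fun o : Option (Fib₀ α.base) => Option.elim o (Σ i, Fib α.base i) fun _ => Unit)
    _ _ _ ⟨none, ⟨i, j⟩⟩ ⟨none, ⟨i', k⟩⟩).trans
    ((StrictOrd.sigma_lt_same _ _ _ _ _).trans ?_)
  exact StrictOrd.sigma_lt_ne _ _ hi _ _

end act

/-! ### The place of the distinguished input -/

/-- The input `j` is sent to the basepoint and precedes the distinguished input of the operation
over the basepoint. -/
def Before {x y : Ib Ass} (α : Ib.Hom x y) (j : Fin y.arity) : Prop :=
  ∃ h : α.base.toFun (some j) = none, α.zero.lt (some ⟨j, h⟩) none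

theorem lt_none_iff_not {S : Type} (r : StrictOrd (Option S)) (s : S) :
    r.lt none (some s) ↔ ¬ r.lt (some s) none := by
  constructor
  · exact fun h h' => r.irrefl _ (r.trans _ _ _ h h')
  · intro h
    rcases r.tri none (some s) with h' | h' | h'
    · exact h'
    · cases h'
    · exact (h h').elim

/-- A morphism of `Tw(Ass)` is determined by its map of pointed sets and by the inputs that precede
the distinguished one. -/
theorem tw_hom_ext {X Y : Tw Ass} {h h' : X ⟶ Y} (hb : Ib.Hom.base h.1 = Ib.Hom.base h'.1)
    (hB : ∀ j, Before h.1 j ↔ Before h'.1 j) : h = h' := by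
  obtain ⟨α, hα⟩ := h
  obtain ⟨β, hβ⟩ := h'
  refine Subtype.ext ?_
  obtain ⟨f, a, b⟩ := α
  obtain ⟨f', a', b'⟩ := β
  obtain rfl : f = f' := hb
  -- Both morphisms produce the order of `Y`. Its restrictions to the fibres are the `b i`, and its
  -- restriction to the fibre over the basepoint is `a` without `none`, so these parts agree; `hB'`
  -- places `none`.
  have hE : act ⟨f, a, b⟩ X.2 = act ⟨f, a', b'⟩ X.2 := hα.trans hβ.symm
  have hB' : ∀ j : Fib₀ f, a.lt (some j) none ↔ a'.lt (some j) none := fun j =>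
    ⟨fun h => ((hB j.1).1 ⟨j.2, h⟩).2, fun h => ((hB j.1).2 ⟨j.2, h⟩).2⟩
  refine Ib.Hom.mk_congr (StrictOrd.ext (funext fun j => funext fun k => propext ?_))
    fun i => StrictOrd.ext (funext fun j => funext fun k => propext ?_)
  · rcases j with _ | j <;> rcases k with _ | k
    · exact iff_of_false (a.irrefl _) (a'.irrefl _)
    · rw [lt_none_iff_not a, lt_none_iff_not a', hB']
    · exact hB' j
    · rw [← act_lt_of_fib₀_of_fib₀ ⟨f, a, b⟩ X.2, hE]
      exact act_lt_of_fib₀_of_fib₀ ⟨f, a', b'⟩ X.2 j k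
  · rw [← act_lt_of_fib ⟨f, a, b⟩ X.2, hE]
    exact act_lt_of_fib ⟨f, a', b'⟩ X.2 j k

theorem before_id (x : Ib Ass) (j : Fin x.arity) : ¬ Before (𝟙 x : x ⟶ x) j :=
  fun h => Option.some_ne_none _ h.1

/-- The operation of `α ≫ β` over the basepoint is that of `β` with an operation built from `α`
plugged into the distinguished input. If `β` sends `j` to the basepoint, then `j` is an outer input
and is compared with the whole inserted block. If `β` sends `j` to `k`, then `j` lies inside that
block, at the place of `k`, and the order of `α` decides. -/
theorem before_comp {x y z : Ib Ass} (α : x ⟶ y) (β : y ⟶ z) (j : Fin z.arity) :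
    Before (α ≫ β) j ↔ Before β j ∨ ∃ k, (Ib.Hom.base β).toFun (some j) = some k ∧ Before α k := by
  rcases hj : (Ib.Hom.base β).toFun (some j) with _ | k
  · have h₁ : (Ib.Hom.base (α ≫ β)).toFun (some j) = none :=
      (congrArg (Ib.Hom.base α).toFun hj).trans (Ib.Hom.base α).map_none
    have key : StrictOrd.lt (Ib.Hom.zero (α ≫ β)) (some ⟨j, h₁⟩) none ↔
        StrictOrd.lt (Ib.Hom.zero β) (some ⟨j, hj⟩) none := by
      refine (gcomp_lt
        (I := fun o : Option (Fib₀ (Ib.Hom.base β)) => Option.elim o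
          (Option (Σ k : Fib₀ (Ib.Hom.base α), Fib (Ib.Hom.base β) k.1)) fun _ => Unit) _ _ _
        -- The distinguished input of the composite is `⟨none, none⟩`: the distinguished input of
        -- the operation inserted at `none`.
        ⟨some ⟨j, hj⟩, ()⟩ ⟨none, none⟩).trans
        (StrictOrd.sigma_lt_ne _ _ (by simp) _ _)
    simp only [reduceCtorEq, false_and, exists_false, or_false]
    exact ⟨fun h => ⟨hj, key.1 h.2⟩, fun h => ⟨h₁, key.2 h.2⟩⟩
  · have hn : ¬ Before β j := fun h => by
      have := h.1
      rw [show β.base.toFun (some j) = some k from hj] at this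
      cases this
    have key : ∀ (hk : (Ib.Hom.base α).toFun (some k) = none)
        (h₁ : (Ib.Hom.base (α ≫ β)).toFun (some j) = none),
        StrictOrd.lt (Ib.Hom.zero (α ≫ β)) (some ⟨j, h₁⟩) none ↔
        StrictOrd.lt (Ib.Hom.zero α) (some ⟨k, hk⟩) none := by
      intro hk h₁
      refine (gcomp_lt
        (I := fun o : Option (Fib₀ (Ib.Hom.base β)) => Option.elim o
          (Option (Σ k : Fib₀ (Ib.Hom.base α), Fib (Ib.Hom.base β) k.1)) fun _ => Unit) _ _ _
        ⟨none, some ⟨⟨k, hk⟩, ⟨j, hj⟩⟩⟩ ⟨none, none⟩).trans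
        ((StrictOrd.sigma_lt_same _ _ _ _ _).trans ?_)
      refine (gcomp_lt
        (I := fun o : Option (Fib₀ (Ib.Hom.base α)) => Option.elim o Unit
          fun k => Fib (Ib.Hom.base β) k.1) _ _ _
        ⟨some ⟨k, hk⟩, ⟨j, hj⟩⟩ ⟨none, ()⟩).trans
        (StrictOrd.sigma_lt_ne _ _ (by simp) _ _)
    simp only [hn, false_or, Option.some.injEq, exists_eq_left']
    constructor
    · rintro ⟨h₁, h⟩
      have hk : (Ib.Hom.base α).toFun (some k) = none :=
        (congrArg (Ib.Hom.base α).toFun hj).symm.trans h₁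
      exact ⟨hk, (key hk h₁).1 h⟩
    · rintro ⟨hk, h⟩
      have h₁ := (congrArg (Ib.Hom.base α).toFun hj).trans hk
      exact ⟨h₁, (key hk h₁).2 h⟩

/-! ### Morphisms with prescribed base and prescribed position of the basepoint -/

section ofBase

variable {x y : Ib Ass} (f : y.pt ⟶ x.pt) (B : Fin y.arity → Prop) (s : StrictOrd (Fin y.arity))
  (hB : ∀ j k, s.lt j k → B k → B j)

/-- The order on `{0} ∪ f⁻¹(0)` that restricts to `s`, and in which the elements that satisfy `B` are
those before the basepoint. -/
def cutOrd (S : Set (Fin y.arity)) : StrictOrd (Option S) where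
  lt
    | none, none => False
    | none, some k => ¬ B k.1
    | some j, none => B j.1
    | some j, some k => s.lt j.1 k.1
  irrefl
    | none => id
    | some _ => s.irrefl _
  trans
    | none, none, _ => fun h => h.elim
    | some _, none, none => fun _ h => h.elim
    | none, some _, none => fun h h' => h h'
    | none, some j, some k => fun h h' h'' => h (hB _ _ h' h'')
    | some j, none, some k => fun h h' => by
      rcases s.tri j.1 k.1 with h₁ | h₁ | h₁
      · exact h₁
      · exact (h' (h₁ ▸ h)).elim
      · exact (h' (hB _ _ h₁ h)).elim
    | some _, some _, none => fun h h' => hB _ _ h h'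
    | some _, some _, some _ => s.trans _ _ _
  tri
    | none, none => .inr (.inl rfl)
    | none, some k => by
      by_cases h : B k.1
      · exact .inr (.inr h)
      · exact .inl h
    | some k, none => by
      by_cases h : B k.1
      · exact .inl h
      · exact .inr (.inr h)
    | some j, some k => by
      rcases s.tri j.1 k.1 with h | h | h
      · exact .inl h
      · exact .inr (.inl (congrArg some (Subtype.ext h)))
      · exact .inr (.inr h)

/-- The morphism of `Ib^Ass` over `f` whose operations are given by `s`, where the elements that
satisfy `B` are those before the basepoint. -/
def ibOfBase : Ib.Hom x y where
  base := f
  zero := cutOrd B s hB {j | f.toFun (some j) = none}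
  op _ := s.comap Subtype.val Subtype.val_injective

theorem before_ibOfBase (j : Fin y.arity) :
    Before (ibOfBase f B s hB) j ↔ f.toFun (some j) = none ∧ B j :=
  ⟨fun h => ⟨h.1, h.2⟩, fun h => ⟨h.1, h.2⟩⟩

/-- All operations are restrictions of `s`, so only comparisons between different blocks need a
condition. By `h₁`, an input over the basepoint lies before every other fibre or after every other
fibre, according to `B`; by `h₂`, the fibres follow each other as `r` prescribes. Totality of the
orders upgrades these implications to equivalences. -/
theorem act_ibOfBase (r : StrictOrd (Fin x.arity))
    (h₁ : ∀ j k i, f.toFun (some j) = none → f.toFun (some k) = some i → (B j ↔ s.lt j k))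
    (h₂ : ∀ j j' i i', f.toFun (some j) = some i → f.toFun (some j') = some i' → r.lt i i' →
      s.lt j j') : act (ibOfBase f B s hB) r = s := by
  refine StrictOrd.ext (funext fun j => funext fun k => propext ?_)
  rcases hj : f.toFun (some j) with _ | i <;> rcases hk : f.toFun (some k) with _ | i'
  · exact act_lt_of_fib₀_of_fib₀ (ibOfBase f B s hB) r ⟨j, hj⟩ ⟨k, hk⟩
  · exact (act_lt_of_fib₀_of_fib (ibOfBase f B s hB) r ⟨j, hj⟩ ⟨k, hk⟩).trans (h₁ _ _ _ hj hk)
  · refine (act_lt_of_fib_of_fib₀ (ibOfBase f B s hB) r ⟨j, hj⟩ ⟨k, hk⟩).trans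
      ((not_congr (h₁ _ _ _ hk hj)).trans ?_)
    constructor
    · intro h
      rcases s.tri j k with h' | rfl | h'
      · exact h'
      · cases hj.symm.trans hk
      · exact (h h').elim
    · exact fun h h' => s.irrefl _ (s.trans _ _ _ h h')
  · by_cases hi : i = i'
    · obtain rfl := hi
      exact act_lt_of_fib (ibOfBase f B s hB) r ⟨j, hj⟩ ⟨k, hk⟩
    · refine (act_lt_of_fib_ne (ibOfBase f B s hB) r hi ⟨j, hj⟩ ⟨k, hk⟩).trans
        ⟨h₂ _ _ _ _ hj hk, fun h => ?_⟩
      rcases r.tri i i' with h' | h' | h'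
      · exact h'
      · exact (hi h').elim
      · exact (s.irrefl _ (s.trans _ _ _ h (h₂ _ _ _ _ hk hj h'))).elim

end ofBase

/-! ### The functor given by the blocks of a monotone map -/

/-- The intervals `(f (i - 1), f i]` cover `(f 0, f m]`: a monotone map that starts below a number
and ends at or above it crosses it at some step. As `j` stands for `j + 1`, the condition `j < f 0`
means `j + 1 ≤ f 0`. -/
theorem iotaFun_eq_none {m n : ℕ} (f : Fin (m + 1) →o Fin (n + 1)) (j : Fin n) :
    iotaFun f (some j) = none ↔ (j : ℕ) < f 0 ∨ (f (Fin.last m) : ℕ) ≤ j := by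
  constructor
  · intro h
    by_contra! hc
    obtain ⟨i, -, -, hi⟩ := exists_step (fun k => (f k : ℕ)) (j + 1) 0 (Fin.last m)
      (Fin.zero_le _) (by omega) (by omega)
    rw [(iotaFun_eq_some f j i).2 hi] at h
    cases h
  · intro h
    rcases hj : iotaFun f (some j) with _ | i
    · rfl
    · rw [iotaFun_eq_some] at hj
      have h₁ := Fin.le_def.1 (f.monotone (Fin.zero_le i.castSucc))
      have h₂ := Fin.le_def.1 (f.monotone (Fin.le_last i.succ))
      omega

/-- The element `k` lies in `(f 0, f m]` and `j` outside it, so being to the left of the interval is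
the same as being to the left of `k`. This gives the condition `h₁` of `act_ibOfBase`, and later
recovers `f` from `ι(f)`. -/
theorem lt_zero_iff_lt_of_iotaFun {m n : ℕ} (f : Fin (m + 1) →o Fin (n + 1)) {j k : Fin n}
    {i : Fin m} (hj : iotaFun f (some j) = none) (hk : iotaFun f (some k) = some i) :
    (j : ℕ) < f 0 ↔ j < k := by
  rw [iotaFun_eq_none] at hj
  rw [iotaFun_eq_some] at hk
  have h₁ := Fin.le_def.1 (f.monotone (Fin.zero_le i.castSucc))
  have h₂ := Fin.le_def.1 (f.monotone (Fin.le_last i.succ))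
  rw [Fin.lt_def]
  omega

theorem lt_of_iotaFun_lt {m n : ℕ} (f : Fin (m + 1) →o Fin (n + 1)) {j k : Fin n}
    {i i' : Fin m} (hj : iotaFun f (some j) = some i) (hk : iotaFun f (some k) = some i')
    (hi : i < i') : j < k := by
  rw [iotaFun_eq_some] at hj hk
  have h := Fin.le_def.1 (f.monotone
    (show i.succ ≤ i'.castSucc from Fin.le_def.2 (Fin.lt_def.1 hi)))
  rw [Fin.lt_def]
  omega

/-- The morphism `μ_m ⟶ μ_n` of `Tw(Ass)` of a monotone map `[m] → [n]`. -/
noncomputable def deltaHom {m n : ℕ} (f : SimplexCategory.mk m ⟶ SimplexCategory.mk n) :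
    mu m ⟶ mu n :=
  ⟨ibOfBase (x := ⟨m⟩) (y := ⟨n⟩) (iotaHom m n f)
      -- With `j` standing for `j + 1`, these are the elements `1, …, f 0`, the first block.
      (fun j => (j : ℕ) < f.toOrderHom 0) (ofPerm 1)
      (fun j k (hjk : j < k) h => (Fin.lt_def.1 hjk).trans h),
    act_ibOfBase _ _ _ _ (ofPerm 1)
      (fun _ _ _ hj hk => lt_zero_iff_lt_of_iotaFun f.toOrderHom hj hk)
      (fun _ _ _ _ hj hk hi => lt_of_iotaFun_lt f.toOrderHom hj hk hi)⟩

theorem before_deltaHom {m n : ℕ} (f : SimplexCategory.mk m ⟶ SimplexCategory.mk n)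
    (j : Fin n) : Before (deltaHom f).1 j ↔ (j : ℕ) < f.toOrderHom 0 := by
  refine (before_ibOfBase _ _ _ _ _).trans ⟨fun h => h.2, fun h => ⟨?_, h⟩⟩
  exact (iotaFun_eq_none f.toOrderHom j).2 (.inl h)

/-- For `f : [m] → [n]`, the elements below `f i` are those below `f 0` and those that `ι(f)` sends below
`i`. -/
theorem lt_toOrderHom_iff {m n : ℕ} (f : Fin (m + 1) →o Fin (n + 1)) (i : Fin (m + 1))
    (j : Fin n) : (j : ℕ) < f i ↔
      (j : ℕ) < f 0 ∨ ∃ k : Fin m, iotaFun f (some j) = some k ∧ (k : ℕ) < i := by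
  constructor
  · intro h
    by_cases h₀ : (j : ℕ) < f 0
    · exact .inl h₀
    · obtain ⟨k, -, hk, hk'⟩ := exists_step (fun k => (f k : ℕ)) (j + 1) 0 i
        (Fin.zero_le _) (by omega) (by omega)
      exact .inr ⟨k, (iotaFun_eq_some _ _ _).2 hk', Fin.le_def.1 hk⟩
  · rintro (h | ⟨k, hk, hki⟩)
    · exact h.trans_le (Fin.le_def.1 (f.monotone (Fin.zero_le _)))
    · rw [iotaFun_eq_some] at hk
      have := Fin.le_def.1 (f.monotone (show k.succ ≤ i from Fin.le_def.2 hki))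
      omega

/-- The functor `Δ ⥤ Tw(Ass)` that sends `[n]` to `μ_n`. -/
noncomputable def delta : SimplexCategory ⥤ Tw Ass where
  obj X := mu X.len
  map {X Y} f := deltaHom (m := X.len) (n := Y.len) f
  map_id X := by
    refine tw_hom_ext (congrArg Quiver.Hom.unop (iota.map_id X)) fun j => ?_
    refine (before_deltaHom (m := X.len) (n := X.len) (𝟙 X) j).trans
      (iff_of_false ?_ (before_id _ j))
    simp
  map_comp {X Y Z} f g := by
    refine tw_hom_ext (congrArg Quiver.Hom.unop (iota.map_comp f g)) fun j => ?_
    refine (before_deltaHom (m := X.len) (n := Z.len) (f ≫ g) j).trans ?_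
    -- Taken at the index `f 0`, this splits the elements below `g (f 0)` into those below `g 0` and
    -- those that `ι(g)` sends below `f 0`, which are the two cases of `before_comp`.
    refine (lt_toOrderHom_iff g.toOrderHom (f.toOrderHom 0) j).trans ?_
    refine Iff.trans ?_ (before_comp _ _ j).symm
    refine or_congr (before_deltaHom (m := Y.len) (n := Z.len) g j).symm
      (exists_congr fun k => and_congr_right fun _ => ?_)
    exact (before_deltaHom (m := X.len) (n := Y.len) f k).symm

/-! ### The functor is fully faithful -/

/-- If `a` and `b` differ, the smaller one is less than `n`, lies below the larger one and not below
itself. -/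
theorem eq_of_forall_lt_iff {n : ℕ} {a b : Fin (n + 1)}
    (h : ∀ j : Fin n, (j : ℕ) < a ↔ (j : ℕ) < b) : a = b := by
  rcases lt_trichotomy a b with hab | hab | hab
  · have hab := Fin.lt_def.1 hab
    have := h ⟨a, by omega⟩
    simp only [lt_irrefl, false_iff] at this
    omega
  · exact hab
  · have hab := Fin.lt_def.1 hab
    have := h ⟨b, by omega⟩
    simp only [lt_irrefl, iff_false] at this
    omega

/-- The morphism records `ι(f)` and, through `Before`, the value `f 0`; by `lt_toOrderHom_iff` these
determine every `f i`. -/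
theorem deltaHom_injective (m n : ℕ) : Function.Injective (deltaHom (m := m) (n := n)) := by
  intro f g h
  refine SimplexCategory.Hom.ext _ _ (OrderHom.ext _ _ (funext fun i => ?_))
  have hι : iotaFun f.toOrderHom = iotaFun g.toOrderHom :=
    congrArg (fun h => FinPtd.Hom.toFun (base h)) h
  have h₀ : ∀ j : Fin n, (j : ℕ) < f.toOrderHom 0 ↔ (j : ℕ) < g.toOrderHom 0 := fun j => by
    rw [← before_deltaHom, h, before_deltaHom]
  refine eq_of_forall_lt_iff fun j => ?_
  rw [lt_toOrderHom_iff, lt_toOrderHom_iff g.toOrderHom, hι]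
  exact or_congr (h₀ j) Iff.rfl

/-- The cut point is the first element outside `S`, or `n` if there is none. -/
theorem exists_lt_iff_of_lower {n : ℕ} (S : Fin n → Prop) (hS : ∀ j k, j < k → S k → S j) :
    ∃ c : Fin (n + 1), ∀ j : Fin n, S j ↔ (j : ℕ) < c := by
  classical
  by_cases h : ∃ c : ℕ, ∃ hc : c < n, ¬ S ⟨c, hc⟩
  · obtain ⟨hc, hn⟩ := Nat.find_spec h
    refine ⟨⟨Nat.find h, by omega⟩, fun j => ⟨fun hj => ?_, fun hj => ?_⟩⟩
    · by_contra! hle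
      rcases (show Nat.find h ≤ j from hle).eq_or_lt with h' | h'
      · exact hn (by simpa only [h'] using hj)
      · exact hn (hS _ _ (Fin.lt_def.2 h') hj)
    · by_contra hj'
      exact Nat.find_min h hj ⟨j.2, hj'⟩
  · push Not at h
    exact ⟨Fin.last n, fun j => iff_of_true (h j j.2) j.2⟩

theorem deltaHom_surjective (m n : ℕ) : Function.Surjective (deltaHom (m := m) (n := n)) := by
  rintro ⟨α, hα⟩
  have hact : act α (ofPerm 1) = ofPerm 1 := hα
  -- `S i` is the union of the first block and the first `i` fibres. It is an initial segment
  -- because `α` produces the standard order, and its length is the cut point `c i`.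
  let S : Fin (m + 1) → Fin n → Prop := fun i j =>
    Before α j ∨ ∃ k : Fin m, α.base.toFun (some j) = some k ∧ (k : ℕ) < i
  have hlt : ∀ j k : Fin n, j < k ↔ (act α (ofPerm 1)).lt j k := fun j k => by
    rw [hact]
    exact Iff.rfl
  have hS : ∀ i j k, j < k → S i k → S i j := by
    intro i j k hjk hk
    rw [hlt] at hjk
    rcases hj : α.base.toFun (some j) with _ | a <;> rcases hk' : α.base.toFun (some k) with _ | b
    · have h₁ := (act_lt_of_fib₀_of_fib₀ α (ofPerm 1) ⟨j, hj⟩ ⟨k, hk'⟩).1 hjk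
      rcases hk with ⟨_, hk⟩ | ⟨k', h', -⟩
      · exact .inl ⟨hj, StrictOrd.trans _ _ _ _ h₁ hk⟩
      · cases hk'.symm.trans h'
    -- Preceding one element of a fibre means preceding the distinguished input, whatever the reason
    -- for `k` to lie in `S i`.
    · exact .inl ⟨hj, (act_lt_of_fib₀_of_fib α (ofPerm 1) ⟨j, hj⟩ ⟨k, hk'⟩).1 hjk⟩
    · have h₁ := (act_lt_of_fib_of_fib₀ α (ofPerm 1) ⟨j, hj⟩ ⟨k, hk'⟩).1 hjk
      rcases hk with ⟨_, hk⟩ | ⟨k', h', -⟩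
      · exact ((lt_none_iff_not _ _).1 h₁ hk).elim
      · cases hk'.symm.trans h'
    · rcases hk with ⟨h', -⟩ | ⟨k', h', hk⟩
      · cases hk'.symm.trans h'
      · obtain rfl := Option.some.inj (hk'.symm.trans h')
        refine .inr ⟨a, hj, ?_⟩
        by_cases hab : a = b
        · rwa [hab]
        · exact (Fin.lt_def.1 ((act_lt_of_fib_ne α (ofPerm 1) hab ⟨j, hj⟩ ⟨k, hk'⟩).1 hjk)).trans hk
  choose c hc using fun i => exists_lt_iff_of_lower (S i) (hS i)
  have hmono : Monotone c := by
    intro i i' hi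
    by_contra! hlt
    have hlt := Fin.lt_def.1 hlt
    -- If `c i' < c i`, the element with index `c i'` lies in `S i`, hence in the larger `S i'`, and
    -- so would be below `c i'`.
    have h₁ := (hc i ⟨c i', by omega⟩).2 hlt
    have h₂ : S i' ⟨c i', by omega⟩ := h₁.imp_right fun ⟨k, hk, hki⟩ =>
      ⟨k, hk, hki.trans_le (Fin.le_def.1 hi)⟩
    exact lt_irrefl _ ((hc i' _).1 h₂)
  refine ⟨SimplexCategory.mkHom ⟨c, hmono⟩, tw_hom_ext (FinPtd.hom_ext ?_) fun j => ?_⟩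
  · rintro (_ | j)
    · exact α.base.map_none.symm
    · refine Option.ext fun i => ?_
      refine (iotaFun_eq_some ⟨c, hmono⟩ j i).trans (Iff.trans ?_
        (Iff.rfl : α.base.toFun (some j) = some i ↔ _))
      -- The condition defining `ι(c)` says that `j` lies in `S i.succ` but not in `S i.castSucc`.
      -- The difference of these sets is the fibre over `i`.
      change (c i.castSucc : ℕ) < j + 1 ∧ (j : ℕ) < c i.succ ↔ _
      refine (and_congr (Nat.lt_succ_iff.trans (not_lt.symm.trans
        (not_congr (hc i.castSucc j).symm))) (hc i.succ j).symm).trans ?_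
      constructor
      · rintro ⟨h₁, h₂ | ⟨k, hk, hki⟩⟩
        · exact (h₁ (.inl h₂)).elim
        · obtain rfl : k = i := by
            by_contra hne
            refine h₁ (.inr ⟨k, hk, ?_⟩)
            have : (k : ℕ) ≠ i := fun h => hne (Fin.ext h)
            simp only [Fin.val_succ, Fin.val_castSucc] at hki ⊢
            omega
          exact hk
      · intro h
        refine ⟨?_, .inr ⟨i, h, by simp⟩⟩
        rintro (⟨h', -⟩ | ⟨k, hk, hki⟩)
        · cases h.symm.trans h'
        · obtain rfl := Option.some.inj (h.symm.trans hk)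
          simp at hki
  -- No fibre contributes to `S 0`, so it is just `Before α`.
  · refine (before_deltaHom _ j).trans ((hc 0 j).symm.trans ?_)
    exact ⟨fun h => h.resolve_right fun ⟨_, _, h⟩ => Nat.not_lt_zero _ h, .inl⟩

/-! ### Essential surjectivity -/

section perm

variable {n : ℕ} {r s : StrictOrd (Fin n)}

/-- A total order on `Fin n`, as an object of `Tw(Ass)`. -/
abbrev twObj (r : StrictOrd (Fin n)) : Tw Ass := ⟨⟨n⟩, r⟩

/-- The morphism of `Tw(Ass)` of an isomorphism of orders. -/
noncomputable def twOfPerm (e : Equiv.Perm (Fin n)) (he : ∀ j k, r.lt (e j) (e k) → s.lt j k) :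
    twObj r ⟶ twObj s :=
  ⟨ibOfBase (x := ⟨n⟩) (y := ⟨n⟩) ⟨Option.map e, rfl⟩ (fun _ => False) s (fun _ _ _ => id),
    act_ibOfBase _ _ _ _ r (fun _ _ _ hj => nomatch hj) (fun j j' _ _ hj hk h => he j j' (by
      obtain rfl := Option.some.inj hj
      obtain rfl := Option.some.inj hk
      exact h))⟩

/-- Underlying pointed maps compose contravariantly, so the composite lies over `e ∘ e'`. Nothing
goes to the basepoint, so `Before` is empty on both sides. -/
theorem twOfPerm_comp_eq_id {e e' : Equiv.Perm (Fin n)} {he : ∀ j k, r.lt (e j) (e k) → s.lt j k}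
    {he' : ∀ j k, s.lt (e' j) (e' k) → r.lt j k} (h : ∀ j, e (e' j) = j) :
    twOfPerm e he ≫ twOfPerm e' he' = 𝟙 _ := by
  refine tw_hom_ext (FinPtd.hom_ext ?_) fun j => iff_of_false ?_ (before_id _ j)
  · rintro (_ | j)
    · rfl
    · exact congrArg some (h j)
  · exact fun h => Option.some_ne_none _ h.1

/-- An isomorphism of orders is an isomorphism of `Tw(Ass)`. -/
noncomputable def twIsoOfPerm (e : Equiv.Perm (Fin n)) (he : ∀ j k, r.lt (e j) (e k) ↔ s.lt j k) :
    twObj r ≅ twObj s where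
  hom := twOfPerm e fun j k => (he j k).1
  inv := twOfPerm e.symm fun j k h => by
    simpa using (he (e.symm j) (e.symm k)).2 h
  hom_inv_id := twOfPerm_comp_eq_id e.apply_symm_apply
  inv_hom_id := twOfPerm_comp_eq_id e.symm_apply_apply

end perm

instance : delta.EssSurj where
  mem_essImage := by
    rintro ⟨⟨n⟩, s⟩
    obtain ⟨σ, rfl⟩ := (ofPerm_bijective n).surjective s
    -- The order of `σ` is the pullback of the standard order along `σ`, so `σ` itself is the
    -- required isomorphism of orders.
    exact ⟨SimplexCategory.mk n, ⟨twIsoOfPerm (r := ofPerm 1) (s := ofPerm σ) σ fun _ _ => Iff.rfl⟩⟩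

instance : delta.Faithful where
  map_injective {X Y} := deltaHom_injective X.len Y.len

instance : delta.Full where
  map_surjective {X Y} := deltaHom_surjective X.len Y.len

/-! ### Constant and non-constant maps -/

theorem homMap_delta (m n : ℕ) : homMap delta (fun _ => rfl) m n = deltaHom :=
  funext fun f => (Category.id_comp (X := mu m) _).trans (Category.comp_id (deltaHom f))

/-- If no element has a nonzero image, the second alternative in `lt_toOrderHom_iff` never occurs,
so every `f i` equals `f 0`. -/
theorem iotaHom_eq_const_iff {m n : ℕ} (f : SimplexCategory.mk m ⟶ SimplexCategory.mk n) :
    iotaHom m n f = FinPtd.const _ _ ↔ f ∈ constMaps m n := by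
  constructor
  · intro h
    refine ⟨f.toOrderHom 0, SimplexCategory.Hom.ext _ _ (OrderHom.ext _ _ (funext fun i => ?_))⟩
    refine eq_of_forall_lt_iff (n := n) fun j => ?_
    refine Iff.trans ?_ (lt_toOrderHom_iff f.toOrderHom i j).symm
    refine ⟨.inl, fun h' => h'.resolve_right ?_⟩
    rintro ⟨k, hk, -⟩
    exact Option.some_ne_none k
      (hk.symm.trans (congrArg (fun g => FinPtd.Hom.toFun g (some j)) h))
  · rintro ⟨i, rfl⟩
    refine FinPtd.hom_ext ?_
    rintro (_ | j)
    · rfl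
    · refine (iotaFun_eq_none _ j).2 ?_
      exact lt_or_ge _ _

/-- The distinguished input has position `i`, and the other inputs fill the remaining positions in
order, so exactly the first `i` of them precede it. -/
theorem before_constHom {m n : ℕ} (i : Fin (n + 1)) (j : Fin n) :
    Before (constHom m n i).1 j ↔ (j : ℕ) < i := by
  have h : Before (constHom m n i).1 j ↔ movePerm i j.succ < movePerm i 0 :=
    ⟨fun h => h.2, fun h => ⟨rfl, h⟩⟩
  rw [h, movePerm_zero, movePerm_succ, Fin.lt_def]
  split_ifs with hji
  · simp [hji]
  · simp only [Fin.val_succ]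
    omega

theorem deltaHom_const (m n : ℕ) (i : Fin (n + 1)) :
    deltaHom (SimplexCategory.const (SimplexCategory.mk m) (SimplexCategory.mk n) i) =
      constHom m n i :=
  tw_hom_ext ((iotaHom_eq_const_iff _).2 ⟨i, rfl⟩) fun j =>
    (before_deltaHom _ j).trans (before_constHom i j).symm

theorem constHom_injective (m n : ℕ) : Function.Injective (constHom m n) := fun i i' h =>
  eq_of_forall_lt_iff fun j => by rw [← before_constHom (m := m), h, before_constHom]

/-- If `ι(f)` is not constant, then it determines `f`. -/
theorem iotaHom_injOn (m n : ℕ) : Set.InjOn (iotaHom m n) (constMaps m n)ᶜ := by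
  intro f hf g _ h
  have hι : iotaFun f.toOrderHom = iotaFun g.toOrderHom := congrArg FinPtd.Hom.toFun h
  obtain ⟨k, i, hk⟩ : ∃ k i, iotaFun f.toOrderHom (some k) = some i := by
    by_contra! hc
    refine hf ((iotaHom_eq_const_iff f).1 (FinPtd.hom_ext ?_))
    rintro (_ | j)
    · rfl
    · exact Option.eq_none_iff_forall_ne_some.2 (hc j)
  -- The fixed element `k` of a middle block describes the first block in terms of `ι(F)` alone: the
  -- elements over the basepoint to the left of `k`.
  have key : ∀ (F : Fin (m + 1) →o Fin (n + 1)) (j : Fin n), iotaFun F (some k) = some i →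
      ((j : ℕ) < F 0 ↔ iotaFun F (some j) = none ∧ j < k) := fun F j hF =>
    ⟨fun hj => have hj' := (iotaFun_eq_none F j).2 (.inl hj)
      ⟨hj', (lt_zero_iff_lt_of_iotaFun F hj' hF).1 hj⟩,
    fun hj => (lt_zero_iff_lt_of_iotaFun F hj.1 hF).2 hj.2⟩
  refine deltaHom_injective m n (tw_hom_ext h fun j => ?_)
  refine (before_deltaHom f j).trans (Iff.trans ?_ (before_deltaHom g j).symm)
  refine (key f.toOrderHom j hk).trans (Iff.trans ?_ (key g.toOrderHom j (hι ▸ hk)).symm)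
  rw [hι]

theorem deltaHom_bijOn (m n : ℕ) {S : Set (SimplexCategory.mk m ⟶ SimplexCategory.mk n)}
    {T : Set (mu m ⟶ mu n)} (h : ∀ f, deltaHom f ∈ T ↔ f ∈ S) : Set.BijOn deltaHom S T :=
  ⟨fun f hf => (h f).2 hf, (deltaHom_injective m n).injOn, fun t ht => by
    obtain ⟨f, rfl⟩ := deltaHom_surjective m n t
    exact ⟨f, (h f).1 ht, rfl⟩⟩

theorem iotaHom_bijOn (m n : ℕ) : Set.BijOn (iotaHom m n) (constMaps m n)ᶜ
    (Set.range (iotaHom m n) \ {FinPtd.const _ _}) :=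
  ⟨fun f hf => ⟨⟨f, rfl⟩, fun h => hf ((iotaHom_eq_const_iff f).1 h)⟩, iotaHom_injOn m n, by
    rintro _ ⟨⟨f, rfl⟩, hf⟩
    exact ⟨f, fun h => hf ((iotaHom_eq_const_iff f).2 h), rfl⟩⟩

end Ass

theorem proposition5p15 :
    ∃ (φ : SimplexCategory ⥤ SymmOperad.Tw Ass)
      (hφ : ∀ n : ℕ, φ.obj (SimplexCategory.mk n) = Ass.mu n),
      φ.IsEquivalence ∧
      ∀ m n : ℕ,
        Function.Bijective (Ass.homMap φ hφ m n) ∧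
        -- the component of the constant maps
        (∀ i : Fin (n + 1),
          Ass.homMap φ hφ m n (SimplexCategory.const _ _ i) = Ass.constHom m n i) ∧
        Function.Injective (Ass.constHom m n) ∧
        Set.range (Ass.constHom m n) =
          {h : Ass.mu m ⟶ Ass.mu n | Ass.base h = FinPtd.const _ _} ∧
        Set.BijOn (Ass.homMap φ hφ m n) (Ass.constMaps m n)
          {h : Ass.mu m ⟶ Ass.mu n | Ass.base h = FinPtd.const _ _} ∧
        -- the component of the other maps
        (∀ f : SimplexCategory.mk m ⟶ SimplexCategory.mk n,
          Ass.base (Ass.homMap φ hφ m n f) = Ass.iotaHom m n f) ∧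
        Set.BijOn (Ass.homMap φ hφ m n) (Ass.constMaps m n)ᶜ
          {h : Ass.mu m ⟶ Ass.mu n | Ass.base h ≠ FinPtd.const _ _} ∧
        Set.BijOn (Ass.base (m := m) (n := n))
          {h : Ass.mu m ⟶ Ass.mu n | Ass.base h ≠ FinPtd.const _ _}
          (Set.range (Ass.iotaHom m n) \ {FinPtd.const _ _}) ∧
        Set.BijOn (Ass.iotaHom m n) (Ass.constMaps m n)ᶜ
          (Set.range (Ass.iotaHom m n) \ {FinPtd.const _ _}) := by
  refine ⟨Ass.delta, fun _ => rfl, { }, fun m n => ?_⟩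
  have hmem : ∀ f, Ass.deltaHom f ∈ {h : Ass.mu m ⟶ Ass.mu n | Ass.base h = FinPtd.const _ _} ↔
      f ∈ Ass.constMaps m n := Ass.iotaHom_eq_const_iff
  have hconst := Ass.deltaHom_bijOn m n hmem
  have hne := Ass.deltaHom_bijOn m n (S := (Ass.constMaps m n)ᶜ)
    (T := {h : Ass.mu m ⟶ Ass.mu n | Ass.base h ≠ FinPtd.const _ _}) fun f => not_congr (hmem f)
  have hι := Ass.iotaHom_bijOn m n
  simp only [Ass.homMap_delta]
  refine ⟨⟨Ass.deltaHom_injective m n, Ass.deltaHom_surjective m n⟩, Ass.deltaHom_const m n,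
    Ass.constHom_injective m n, ?_, hconst, fun f => rfl, hne, ?_, hι⟩
  -- The morphisms over the constant map are the image of the constant maps, which `deltaHom_const`
  -- identifies with the family `constHom`.
  · rw [← hconst.image_eq, Ass.constMaps, ← Set.range_comp]
    exact congrArg Set.range (funext fun i => (Ass.deltaHom_const m n i).symm)
  -- Since `ι` factors as `base` after `deltaHom`, the bijectivity of `ι` and of `deltaHom` on the
  -- non-constant maps gives that of `base`.
  · have hcomp : Ass.base ∘ Ass.deltaHom = Ass.iotaHom m n := rfl
    rw [← hcomp] at hι ⊢
    rw [← hne.image_eq]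
    exact (Set.bijOn_comp_iff hne.injOn).1 hι
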